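/- For $n\ge 0$ and $\varepsilon\in(0,\tfrac12]$ let $X=X_1\cdots X_n$ and $Y=Y_1\cdots Y_n$, where $X_1,\dots,X_n,Y_1,\dots,Y_n$ are independent, each equal to $1$ with probability $\varepsilon$ and to $0$ with probability $1-\varepsilon$. Given $(X,Y)$, let $(\tilde X,\tilde Y)$ be obtained by choosing one of the ones occurring in $X$ and $Y$ uniformly at random, among all ones of both strings, and turning it into a $0$; if there is no one, put $(\tilde X,\tilde Y)=(X,Y)$. Let $L$ and $\tilde L$ be the lengths of the longest common subsequences of $X,Y$ and of $\tilde X,\tilde Y$, respectively. Theorem 2.2. There exist constants $\alpha_1>\alpha_2$, depending neither on $n$ nor on $\varepsilon$, and sets $B_n\subset\{0,1\}^n\times\{0,1\}^n$ (for all $n$), not depending on $\varepsilon$, such that for every $\varepsilon\in(0,\tfrac12]$, every $n$ and all $(x,y)\in B_n$ $$P(\tilde L-L=1\mid X=x,\,Y=y)\ \ge\ \alpha_1,\qquad P(\tilde L-L=-1\mid X=x,\,Y=y)\ \le\ \alpha_2 .$$ Moreover, there exists $\varepsilon_0\in(0,\tfrac12]$ such that for every $0<\varepsilon\le\varepsilon_0$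 there is a constant $c_1>0$, which may depend on $\varepsilon$ but not on $n$, with $$P((X,Y)\in B_n)\ \ge\ 1-e^{-c_1 n}\qquad\text{for all } n .$$ -/

import Mathlib

open MeasureTheory ProbabilityTheory

noncomputable section

/-- Binary strings of length `n`. -/
abbrev Text (n : ℕ) : Type := Fin n → Fin 2

/-- Pairs `(x, y)` of binary strings of length `n`. -/
abbrev TextPair (n : ℕ) : Type := Text n × Text n

/-- `x` and `y` have a common subsequence of length `k`: there are indices
`i₁ < ⋯ < iₖ` and `j₁ < ⋯ < jₖ` such that `x` at `iₗ` equals `y` at `jₗ` for every `l`. -/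
def HasCommonSubseq {n : ℕ} (x y : Text n) (k : ℕ) : Prop :=
  ∃ i j : Fin k → Fin n, StrictMono i ∧ StrictMono j ∧ ∀ l, x (i l) = y (j l)

/-- Length of the longest common subsequence of `p.1` and `p.2`. -/
def lcs {n : ℕ} (p : TextPair n) : ℕ := sSup {k | HasCommonSubseq p.1 p.2 k}

/-- The supremum defining `lcs` is a maximum. -/
theorem lcs_isGreatest {n : ℕ} (p : TextPair n) :
    IsGreatest {k | HasCommonSubseq p.1 p.2 k} (lcs p) := by
  have hne : {k | HasCommonSubseq p.1 p.2 k}.Nonempty :=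
    ⟨0, Fin.elim0, Fin.elim0, fun a => a.elim0, fun a => a.elim0, fun a => a.elim0⟩
  have hb : BddAbove {k | HasCommonSubseq p.1 p.2 k} := by
    refine ⟨n, ?_⟩
    rintro k ⟨i, -, hi, -, -⟩
    simpa using Fintype.card_le_of_injective i hi.injective
  exact ⟨Nat.sSup_mem hne hb, fun k hk => le_csSup hb hk⟩

/-- The symbol at a position of the pair; `Sum.inl i` is position `i` of the first string,
`Sum.inr j` is position `j` of the second one. -/
def symbolAt {n : ℕ} (p : TextPair n) : Fin n ⊕ Fin n → Fin 2 := Sum.elim p.1 p.2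

/-- The positions of all ones, in both strings together. -/
def onePositions {n : ℕ} (p : TextPair n) : Finset (Fin n ⊕ Fin n) :=
  Finset.univ.filter fun s => symbolAt p s = 1

/-- Write a zero at the position `s`. -/
def putZero {n : ℕ} (p : TextPair n) : Fin n ⊕ Fin n → TextPair n
  | Sum.inl i => (Function.update p.1 i 0, p.2)
  | Sum.inr j => (p.1, Function.update p.2 j 0)

/-- Law of the pair obtained from `p` by choosing one of its ones uniformly at random (among all
ones of both strings) and turning it into a zero; if there is no one, then nothing changes. -/
def flipLaw {n : ℕ} (p : TextPair n) : PMF (TextPair n) :=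
  if h : (onePositions p).Nonempty then (PMF.uniformOfFinset (onePositions p) h).map (putZero p)
  else PMF.pure p

/-- `flipLaw` as a Markov kernel. -/
def flipKernel (n : ℕ) : Kernel (TextPair n) (TextPair n) :=
  Kernel.ofFunOfCountable fun p => (flipLaw p).toMeasure

/-- Law of a string of `n` independent symbols, each one equal to `1` with probability `ε`
and to `0` with probability `1 - ε`. -/
def textLaw (n : ℕ) (ε : unitInterval) : Measure (Text n) :=
  Measure.pi fun _ => bernoulliMeasure (1 : Fin 2) 0 ε

/-- Law of `((X, Y), (X̃, Ỹ))`: `X` and `Y` are independent with law `textLaw n ε`, and given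
`(X, Y)` the pair `(X̃, Ỹ)` arises by turning a uniformly chosen one into a zero. -/
def jointLaw (n : ℕ) (ε : unitInterval) : Measure (TextPair n × TextPair n) :=
  ((textLaw n ε).prod (textLaw n ε)) ⊗ₘ flipKernel n

/-- The event that `(X, Y) ∈ B`. -/
def originalIn {n : ℕ} (B : Set (TextPair n)) : Set (TextPair n × TextPair n) :=
  {ω | ω.1 ∈ B}

/-- The event that the length of the longest common subsequence of `(X̃, Ỹ)` minus that of
`(X, Y)` equals `d`. -/
def lcsChange (n : ℕ) (d : ℤ) : Set (TextPair n × TextPair n) :=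
  {ω | (lcs ω.2 : ℤ) - (lcs ω.1 : ℤ) = d}

end

open scoped ENNReal

noncomputable section

/-! A common subsequence cuts both strings at its matched ones into pairs of segments. The score of
such an alignment is the number of matched ones plus, for each pair, the smaller number of zeros,
and the best score is the LCS up to a shift by one. Take an optimal alignment with as many matched
ones as possible. Flipping a one in a segment with strictly fewer zeros than its partner raises the
LCS, and only flips of matched ones can lower it. If two paired segments have equally many zeros, no
one of the first lies close to a one of the second: matching the two would cost at most one zero and
give an optimal alignment with more matched ones. The surplus zeros number at most twice the number
of segment pairs plus the difference of the two zero counts (`exists_good_alignment`).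

A pair of strings with few raising or many lowering ones thus has an atypical alignment, and a union
bound over alignments shows that such pairs are rare. Give each letter `exp b` times its
probability, each segment pair a factor `exp c`, each surplus zero `exp (-τ)` and each one in the
segment with fewer zeros `exp (-ζ)`. If the total weight of one segment pair with its two separating
ones is below `1`, the sum over all alignments is bounded by a geometric series, and the strings
with an alignment whose extra factors have product at least `exp E` have probability at most `C *
exp (-(2 * b * n) - E)` (`exists_sum_pairMass_le`).

For few raising ones, `b > 0` is possible: the absence of close ones makes pairs with equally many
zeros light, and `ζ` does this for the others (`stepWeight_noClosePairs_lt_one`). For many lowering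
ones, `b < 0` is of order `ε ^ 2`, which costs `exp (O(ε ^ 2 * n))`, while the number of matched
ones is at least of order `ε * n` and earns more when `ε` is small (`stepWeight_true_lt_one`).
Chernoff bounds for the numbers of ones complete the estimate. -/

/-! ### Longest common subsequences of lists -/

/-- Length of the longest common subsequence of two lists. -/
def listLcs (x y : List Bool) : ℕ :=
  sSup {k | ∃ m : List Bool, m.Sublist x ∧ m.Sublist y ∧ m.length = k}

theorem listLcs_isGreatest (x y : List Bool) :
    IsGreatest {k | ∃ m : List Bool, m.Sublist x ∧ m.Sublist y ∧ m.length = k} (listLcs x y) := by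
  have hb : BddAbove {k | ∃ m : List Bool, m.Sublist x ∧ m.Sublist y ∧ m.length = k} := by
    refine ⟨x.length, ?_⟩
    rintro k ⟨m, hx, -, rfl⟩
    exact hx.length_le
  exact ⟨Nat.sSup_mem ⟨0, [], by simp, by simp, rfl⟩ hb, fun k hk => le_csSup hb hk⟩

theorem length_le_listLcs {x y m : List Bool} (hx : m.Sublist x) (hy : m.Sublist y) :
    m.length ≤ listLcs x y :=
  (listLcs_isGreatest x y).2 ⟨m, hx, hy, rfl⟩

theorem exists_length_eq_listLcs (x y : List Bool) :
    ∃ m : List Bool, m.Sublist x ∧ m.Sublist y ∧ m.length = listLcs x y :=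
  (listLcs_isGreatest x y).1

theorem listLcs_comm (x y : List Bool) : listLcs x y = listLcs y x := by
  unfold listLcs
  congr 1
  ext k
  constructor <;> rintro ⟨m, h1, h2, h3⟩ <;> exact ⟨m, h2, h1, h3⟩

/-! ### Flipping a one and counting flips -/

/-- `v` arises from `u` by turning one `true` into `false`. -/
def IsFlip (u v : List Bool) : Prop :=
  ∃ a b : List Bool, u = a ++ true :: b ∧ v = a ++ false :: b

theorem IsFlip.append_left {u v : List Bool} (h : IsFlip u v) (w : List Bool) :
    IsFlip (w ++ u) (w ++ v) := by
  obtain ⟨a, b, rfl, rfl⟩ := h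
  exact ⟨w ++ a, b, by simp, by simp⟩

theorem IsFlip.append_right {u v : List Bool} (h : IsFlip u v) (w : List Bool) :
    IsFlip (u ++ w) (v ++ w) := by
  obtain ⟨a, b, rfl, rfl⟩ := h
  exact ⟨a, b ++ w, by simp, by simp⟩

theorem IsFlip.cons {u v : List Bool} (h : IsFlip u v) (b : Bool) :
    IsFlip (b :: u) (b :: v) := h.append_left [b]

theorem IsFlip.count_false {u v : List Bool} (h : IsFlip u v) :
    v.count false = u.count false + 1 := by
  obtain ⟨a, b, rfl, rfl⟩ := h
  simp only [List.count_append, List.count_cons]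
  simp
  omega

/-- A common subsequence uses the changed position at most once, and dropping that symbol leaves a
common subsequence for the other list. -/
theorem listLcs_replace_le (a b y : List Bool) (s t : Bool) :
    listLcs (a ++ s :: b) y ≤ listLcs (a ++ t :: b) y + 1 := by
  obtain ⟨m, hx, hy, hm⟩ := exists_length_eq_listLcs (a ++ s :: b) y
  rw [← hm]
  obtain ⟨m₁, m₂, rfl, h1, h2⟩ := List.sublist_append_iff.1 hx
  have key : ∀ m₃ : List Bool, m₃.Sublist m₂ → m₃.Sublist b →
      m₂.length ≤ m₃.length + 1 → (m₁ ++ m₂).length ≤ listLcs (a ++ t :: b) y + 1 := by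
    intro m₃ h3 h4 h5
    have := length_le_listLcs (x := a ++ t :: b) (y := y) (m := m₁ ++ m₃)
      (h1.append (h4.trans (List.sublist_cons_self t b)))
      ((List.Sublist.append (List.Sublist.refl m₁) h3).trans hy)
    simp only [List.length_append] at this ⊢
    omega
  cases h2 with
  | cons _ h => exact key m₂ (List.Sublist.refl _) h (by omega)
  | cons_cons _ h => exact key _ (List.sublist_cons_self _ _) h (by simp)

theorem IsFlip.listLcs_le {u v : List Bool} (h : IsFlip u v) (y : List Bool) :
    listLcs v y ≤ listLcs u y + 1 := by
  obtain ⟨a, b, rfl, rfl⟩ := h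
  exact listLcs_replace_le a b y false true

/-- The number of entries `true` of a list which can be turned into `false` such that the
resulting list satisfies `P`. -/
def flipCount (P : List Bool → Prop) : List Bool → ℕ
  | [] => 0
  -- The prefix already read is absorbed into the predicate, so `P` always judges the whole list.
  | b :: t => (open Classical in if b = true ∧ P (false :: t) then 1 else 0) +
      flipCount (fun l => P (b :: l)) t

theorem flipCount_append (P : List Bool → Prop) (u v : List Bool) :
    flipCount P (u ++ v) =
      flipCount (fun l => P (l ++ v)) u + flipCount (fun l => P (u ++ l)) v := by
  induction u generalizing P with
  | nil => simp [flipCount]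
  | cons b t ih => simp [flipCount, ih, add_assoc]

theorem flipCount_eq_count {P : List Bool → Prop} {u : List Bool}
    (h : ∀ v, IsFlip u v → P v) : flipCount P u = u.count true := by
  induction u generalizing P with
  | nil => simp [flipCount]
  | cons b t ih =>
    rw [flipCount, ih fun v hv => h _ (hv.cons b)]
    cases b
    · simp
    · have : P (false :: t) := h _ ⟨[], t, rfl, rfl⟩
      simp [this, add_comm]

theorem flipCount_eq_zero {P : List Bool → Prop} {u : List Bool}
    (h : ∀ v, IsFlip u v → ¬ P v) : flipCount P u = 0 := by
  induction u generalizing P with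
  | nil => simp [flipCount]
  | cons b t ih =>
    rw [flipCount, ih fun v hv => h _ (hv.cons b)]
    cases b
    · simp
    · have : ¬ P (false :: t) := h _ ⟨[], t, rfl, rfl⟩
      simp [this]

/-! ### Alignments and their scores -/

/-- A pair of segments. -/
abbrev SegPair : Type := List Bool × List Bool

/-- Concatenate segments, each preceded by a `true`. -/
def joinOnes (π : SegPair → List Bool) (l : List SegPair) : List Bool :=
  l.flatMap fun s => true :: π s

@[simp] theorem joinOnes_nil (π : SegPair → List Bool) : joinOnes π [] = [] := rfl

@[simp] theorem joinOnes_cons (π : SegPair → List Bool) (s : SegPair) (l : List SegPair) :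
    joinOnes π (s :: l) = true :: (π s ++ joinOnes π l) := by
  simp [joinOnes]

@[simp] theorem joinOnes_append (π : SegPair → List Bool) (l m : List SegPair) :
    joinOnes π (l ++ m) = joinOnes π l ++ joinOnes π m := by
  simp [joinOnes]

theorem joinOnes_swap (l : List SegPair) :
    joinOnes Prod.fst (l.map Prod.swap) = joinOnes Prod.snd l ∧
      joinOnes Prod.snd (l.map Prod.swap) = joinOnes Prod.fst l := by
  induction l with
  | nil => simp
  | cons s t ih => simp [ih]

theorem length_le_length_joinOnes (π : SegPair → List Bool) (l : List SegPair) :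
    l.length ≤ (joinOnes π l).length := by
  induction l with
  | nil => simp
  | cons s t ih => simp; omega

/-- An alignment of `x` and `y`: the ones separating the segments are matched with one another. -/
def IsAlignment (x y : List Bool) (l : List SegPair) : Prop :=
  joinOnes Prod.fst l = true :: x ∧ joinOnes Prod.snd l = true :: y

theorem IsAlignment.swap {x y : List Bool} {l : List SegPair} (h : IsAlignment x y l) :
    IsAlignment y x (l.map Prod.swap) :=
  ⟨(joinOnes_swap l).1.trans h.2, (joinOnes_swap l).2.trans h.1⟩

/-- Number of matched symbols of an alignment in which, between two matched ones, as many zeros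
as possible are matched. -/
def score (l : List SegPair) : ℕ :=
  (l.map fun s => 1 + min (s.1.count false) (s.2.count false)).sum

@[simp] theorem score_nil : score [] = 0 := rfl

@[simp] theorem score_cons (s : SegPair) (l : List SegPair) :
    score (s :: l) = 1 + min (s.1.count false) (s.2.count false) + score l := by
  simp [score]

theorem score_swap (l : List SegPair) : score (l.map Prod.swap) = score l := by
  simp [score, Function.comp_def, min_comm]

/-- The common subsequence belonging to an alignment. -/
def commonPart (l : List SegPair) : List Bool :=
  l.flatMap fun s => true :: List.replicate (min (s.1.count false) (s.2.count false)) false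

theorem length_commonPart (l : List SegPair) : (commonPart l).length = score l := by
  induction l with
  | nil => simp [commonPart, score]
  | cons s t ih =>
    simp only [commonPart, score, List.flatMap_cons, List.map_cons, List.sum_cons,
      List.length_append, List.length_cons, List.length_replicate] at ih ⊢
    omega

theorem commonPart_sublist (l : List SegPair) : (commonPart l).Sublist (joinOnes Prod.fst l) ∧
    (commonPart l).Sublist (joinOnes Prod.snd l) := by
  induction l with
  | nil => simp [commonPart]
  | cons s t ih =>
    have h : commonPart (s :: t) = true ::
        (List.replicate (min (s.1.count false) (s.2.count false)) false ++ commonPart t) := by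
      simp [commonPart]
    rw [h, joinOnes_cons, joinOnes_cons]
    exact ⟨List.Sublist.cons_cons _ (List.Sublist.append
        (List.replicate_sublist_iff.2 (min_le_left _ _)) ih.1),
      List.Sublist.cons_cons _ (List.Sublist.append
        (List.replicate_sublist_iff.2 (min_le_right _ _)) ih.2)⟩

/-- The `+ 1` is the artificial `true` put in front of both lists, which lets the first segment pair
have a separator like all others. -/
theorem IsAlignment.score_le {x y : List Bool} {l : List SegPair} (h : IsAlignment x y l) :
    score l ≤ listLcs x y + 1 := by
  obtain ⟨h1, h2⟩ := commonPart_sublist l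
  rw [h.1] at h1
  rw [h.2] at h2
  rw [← length_commonPart]
  cases l with
  | nil => simp [commonPart]
  | cons s t =>
    have hc : commonPart (s :: t) = true ::
        (List.replicate (min (s.1.count false) (s.2.count false)) false ++ commonPart t) := by
      simp [commonPart]
    rw [hc] at h1 h2 ⊢
    rw [List.cons_sublist_cons] at h1 h2
    have := length_le_listLcs h1 h2
    simpa using this

theorem exists_split_of_cons_sublist {b : Bool} {m x : List Bool} (h : (b :: m).Sublist x) :
    ∃ u v : List Bool, x = u ++ b :: v ∧ m.Sublist v := by
  obtain ⟨r₁, r₂, rfl, hb, hm⟩ := List.cons_sublist_iff.1 h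
  obtain ⟨s, t, rfl⟩ := List.append_of_mem hb
  exact ⟨s, t ++ r₂, by simp, hm.trans (List.sublist_append_right t r₂)⟩

theorem exists_alignment_of_sublist {m x y : List Bool} (hx : m.Sublist x) (hy : m.Sublist y) :
    ∃ l, IsAlignment x y l ∧ m.length + 1 ≤ score l := by
  induction m generalizing x y with
  | nil => exact ⟨[(x, y)], by simp [IsAlignment], by simp [score]⟩
  | cons b m ih =>
    obtain ⟨u, x', rfl, hx'⟩ := exists_split_of_cons_sublist hx
    obtain ⟨v, y', rfl, hy'⟩ := exists_split_of_cons_sublist hy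
    obtain ⟨l, hl, hs⟩ := ih hx' hy'
    cases b with
    | true =>
      refine ⟨(u, v) :: l, by simp [IsAlignment, hl.1, hl.2], ?_⟩
      simp only [score, List.map_cons, List.sum_cons, List.length_cons] at hs ⊢
      omega
    -- A matched zero, with all symbols skipped before it, is merged into the first segment pair, so
    -- that both zero counts grow by at least one.
    | false =>
      cases l with
      | nil => simp [IsAlignment] at hl
      | cons s t =>
        simp only [IsAlignment, joinOnes_cons, List.cons.injEq, true_and] at hl
        refine ⟨(u ++ false :: s.1, v ++ false :: s.2) :: t, ?_, ?_⟩
        · simp [IsAlignment, ← hl.1, ← hl.2]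
        · simp only [score, List.map_cons, List.sum_cons, List.length_cons, List.count_append,
            List.count_cons_self] at hs ⊢
          omega

/-- Maximality of the number of matched ones among the optimal alignments is what later excludes
close pairs of ones. -/
theorem exists_optimal_alignment (x y : List Bool) :
    ∃ l, IsAlignment x y l ∧ score l = listLcs x y + 1 ∧
      ∀ l', IsAlignment x y l' → score l' = listLcs x y + 1 → l'.length ≤ l.length := by
  set S := {k | ∃ l, IsAlignment x y l ∧ score l = listLcs x y + 1 ∧ l.length = k} with hS
  have hb : BddAbove S := by
    refine ⟨x.length + 1, ?_⟩
    rintro k ⟨l, hl, -, rfl⟩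
    have := length_le_length_joinOnes Prod.fst l
    rwa [hl.1] at this
  have hne : S.Nonempty := by
    obtain ⟨m, hx, hy, hm⟩ := exists_length_eq_listLcs x y
    obtain ⟨l, hl, hs⟩ := exists_alignment_of_sublist hx hy
    exact ⟨_, l, hl, le_antisymm hl.score_le (hm ▸ hs), rfl⟩
  obtain ⟨l, hl, hs, hk⟩ := Nat.sSup_mem hne hb
  exact ⟨l, hl, hs, fun l' hl' hs' => hk ▸ le_csSup hb ⟨l', hl', hs', rfl⟩⟩

/-! ### Consequences of optimality -/

/-- Difference of the numbers of zeros of the two segments. -/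
def zeroGap (s : SegPair) : ℕ :=
  (s.1.count false - s.2.count false) + (s.2.count false - s.1.count false)

/-- There are no two ones, one in each string, whose numbers of preceding zeros differ by at
most `1`. -/
def NoClosePairs (x y : List Bool) : Prop :=
  ∀ a b c d : List Bool, x = a ++ true :: b → y = c ++ true :: d →
    a.count false ≤ c.count false + 1 → c.count false ≤ a.count false + 1 → False

/-- Number of ones of the first segment if this is the segment with fewer zeros. -/
def scarceOnes (s : SegPair) : ℕ :=
  if s.1.count false < s.2.count false then s.1.count true else 0

/-- Summation of `2 * min a b + |a - b| = a + b` over the segment pairs. -/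
theorem two_mul_score (l : List SegPair) : 2 * score l + (l.map zeroGap).sum =
    2 * l.length + (joinOnes Prod.fst l).count false + (joinOnes Prod.snd l).count false := by
  induction l with
  | nil => simp
  | cons s t ih =>
    simp only [score_cons, List.map_cons, List.sum_cons, List.length_cons, joinOnes_cons,
      List.count_cons, List.count_append, zeroGap] at ih ⊢
    simp
    omega

theorem sum_scarceOnes_le_flipCount {l : List SegPair} {P : List Bool → Prop}
    (h : ∀ p s r u, l = p ++ s :: r → s.1.count false < s.2.count false → IsFlip s.1 u →
      P (joinOnes Prod.fst (p ++ (u, s.2) :: r))) :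
    (l.map scarceOnes).sum ≤ flipCount P (joinOnes Prod.fst l) := by
  induction l generalizing P with
  | nil => simp
  | cons s t ih =>
    rw [joinOnes_cons, flipCount, flipCount_append, List.map_cons, List.sum_cons]
    have h1 : scarceOnes s ≤ flipCount (fun m => P (true :: (m ++ joinOnes Prod.fst t))) s.1 := by
      unfold scarceOnes
      split_ifs with hs
      · rw [flipCount_eq_count]
        intro u hu
        simpa using h [] s t u rfl hs hu
      · exact Nat.zero_le _
    have h2 := ih (P := fun m => P (true :: (s.1 ++ m))) fun p s' r u hl hs hu => by
      simpa using h (s :: p) s' r u (by simp [hl]) hs hu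
    omega

/-- Only the separators are left to satisfy `P`, and there is one per segment pair. -/
theorem flipCount_joinOnes_le_length {l : List SegPair} {P : List Bool → Prop}
    (h : ∀ p s r u, l = p ++ s :: r → IsFlip s.1 u →
      ¬ P (joinOnes Prod.fst (p ++ (u, s.2) :: r))) :
    flipCount P (joinOnes Prod.fst l) ≤ l.length := by
  induction l generalizing P with
  | nil => simp [flipCount]
  | cons s t ih =>
    rw [joinOnes_cons, flipCount, flipCount_append, List.length_cons]
    have h1 : flipCount (fun m => P (true :: (m ++ joinOnes Prod.fst t))) s.1 = 0 := by
      refine flipCount_eq_zero fun u hu => ?_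
      simpa using h [] s t u rfl hu
    have h2 := ih (P := fun m => P (true :: (s.1 ++ m))) fun p s' r u hl hu => by
      simpa using h (s :: p) s' r u (by simp [hl]) hu
    rw [h1]
    split_ifs <;> omega

theorem IsAlignment.flip {x y : List Bool} {p r : List SegPair} {s : SegPair} {u : List Bool}
    (h : IsAlignment x y (p ++ s :: r)) (hu : IsFlip s.1 u) :
    ∃ x', IsFlip x x' ∧ IsAlignment x' y (p ++ (u, s.2) :: r) := by
  cases p with
  | nil =>
    simp only [IsAlignment, List.nil_append, joinOnes_cons, List.cons.injEq, true_and] at h ⊢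
    exact ⟨_, h.1 ▸ hu.append_right _, rfl, h.2⟩
  | cons s' p =>
    simp only [IsAlignment, List.cons_append, joinOnes_cons, joinOnes_append, List.cons.injEq,
      true_and] at h ⊢
    exact ⟨_, h.1 ▸ (((hu.append_right _).cons true).append_left _).append_left _, rfl, h.2⟩

theorem score_append_cons (p r : List SegPair) (s : SegPair) :
    score (p ++ s :: r) = score p + (1 + min (s.1.count false) (s.2.count false)) + score r := by
  simp [score, add_assoc]

/-- A new zero in the segment with strictly fewer zeros raises the minimum, hence the score of the
same alignment; a single flip cannot gain more than one. -/
theorem sum_scarceOnes_le {x y : List Bool} {l : List SegPair} (hl : IsAlignment x y l)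
    (hs : score l = listLcs x y + 1) :
    (l.map scarceOnes).sum ≤ flipCount (fun x' => listLcs x' y = listLcs x y + 1) x := by
  have := sum_scarceOnes_le_flipCount (l := l)
    (P := fun m => listLcs m.tail y = listLcs x y + 1) (by
      intro p s r u hp hlt hu
      subst hp
      obtain ⟨x', hx', hal⟩ := hl.flip hu
      rw [hal.1, List.tail_cons]
      have h1 := hal.score_le
      have h2 := hu.count_false
      rw [score_append_cons] at hs h1
      simp only [h2] at h1
      refine le_antisymm (hx'.listLcs_le y) ?_
      omega)
  -- Flipping the artificial leading one leaves the tail `x` unchanged, so it contributes nothing to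
  -- the count.
  rw [hl.1, flipCount] at this
  simpa using this

/-- Flipping an unmatched one keeps the alignment and does not reduce any zero count, so the LCS can
drop only at a matched one. -/
theorem flipCount_le_length {x y : List Bool} {l : List SegPair} (hl : IsAlignment x y l)
    (hs : score l = listLcs x y + 1) :
    flipCount (fun x' => listLcs x' y + 1 = listLcs x y) x ≤ l.length := by
  have := flipCount_joinOnes_le_length (l := l)
    (P := fun m => listLcs m.tail y + 1 = listLcs x y) (by
      intro p s r u hp hu
      subst hp
      obtain ⟨x', hx', hal⟩ := hl.flip hu
      rw [hal.1, List.tail_cons]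
      have h1 := hal.score_le
      have h2 := hu.count_false
      rw [score_append_cons] at hs h1
      simp only [h2] at h1
      omega)
  rw [hl.1, flipCount] at this
  simpa using this

/-- Matching two close ones splits the segment pair. As the totals of zeros agree, the two minima
lose at most one zero, which the new matched one makes up for; the longer alignment contradicts
`hmax`. -/
theorem noClosePairs_of_optimal {x y : List Bool} {l : List SegPair} (hl : IsAlignment x y l)
    (hs : score l = listLcs x y + 1)
    (hmax : ∀ l', IsAlignment x y l' → score l' = listLcs x y + 1 → l'.length ≤ l.length)
    {s : SegPair} (hmem : s ∈ l) (heq : s.1.count false = s.2.count false) :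
    NoClosePairs s.1 s.2 := by
  intro a b c d hx hy h1 h2
  obtain ⟨p, r, rfl⟩ := List.append_of_mem hmem
  have hal : IsAlignment x y (p ++ (a, c) :: (b, d) :: r) := by
    have h := hl
    simp only [IsAlignment, joinOnes_append, joinOnes_cons, hx, hy] at h ⊢
    simpa using h
  have h3 := hal.score_le
  have h4 : score (p ++ (a, c) :: (b, d) :: r) = score p + (1 + min (a.count false) (c.count false))
      + ((1 + min (b.count false) (d.count false)) + score r) := by
    rw [score_append_cons]; simp [score]
  have h5 := hs
  rw [score_append_cons] at h5
  rw [hx, hy, List.count_append, List.count_append, List.count_cons, List.count_cons] at heq h5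
  simp only [beq_iff_eq, Bool.true_eq_false, if_false, add_zero] at heq h5
  have := hmax _ hal (by omega)
  simp at this

theorem exists_good_alignment (x y : List Bool) : ∃ l, IsAlignment x y l ∧
    (l.map zeroGap).sum ≤ 2 * l.length +
      ((x.count false - y.count false) + (y.count false - x.count false)) ∧
    (∀ s ∈ l, s.1.count false = s.2.count false → NoClosePairs s.1 s.2) ∧
    (l.map fun s => scarceOnes s + scarceOnes s.swap).sum ≤
      flipCount (fun x' => listLcs x' y = listLcs x y + 1) x +
        flipCount (fun y' => listLcs x y' = listLcs x y + 1) y ∧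
    flipCount (fun x' => listLcs x' y + 1 = listLcs x y) x +
      flipCount (fun y' => listLcs x y' + 1 = listLcs x y) y ≤ 2 * l.length := by
  obtain ⟨l, hl, hs, hmax⟩ := exists_optimal_alignment x y
  have hs' : score (l.map Prod.swap) = listLcs y x + 1 := by
    rw [score_swap, hs, listLcs_comm]
  refine ⟨l, hl, ?_, fun s hsl heq => noClosePairs_of_optimal hl hs hmax hsl heq, ?_, ?_⟩
  · have h1 := two_mul_score l
    -- Matching only zeros shows that the LCS is at least the smaller zero count; with
    -- `two_mul_score` this bounds the total gap.
    have h2 := (show IsAlignment x y [(x, y)] by simp [IsAlignment]).score_le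
    rw [hl.1, hl.2] at h1
    simp only [score_cons, score_nil, List.count_cons] at h1 h2
    simp at h1
    omega
  · have h1 := sum_scarceOnes_le hl hs
    have h2 := sum_scarceOnes_le hl.swap hs'
    rw [List.sum_map_add]
    simp only [listLcs_comm _ x, List.map_map, Function.comp_def] at h2
    exact add_le_add h1 h2
  · have h1 := flipCount_le_length hl hs
    have h2 := flipCount_le_length hl.swap hs'
    simp only [listLcs_comm _ x, List.length_map] at h2
    omega

/-! ### Translation between texts and lists -/

/-- A text as a list, `true` standing for the symbol `1`. -/
def textList {n : ℕ} (x : Text n) : List Bool := List.ofFn fun i => decide (x i = 1)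

@[simp] theorem length_textList {n : ℕ} (x : Text n) : (textList x).length = n := by
  simp [textList]

theorem textList_succ {n : ℕ} (x : Text (n + 1)) :
    textList x = decide (x 0 = 1) :: textList (Fin.tail x) := by
  simp only [textList, List.ofFn_succ]
  rfl

theorem decide_eq_one_inj {a b : Fin 2} (h : decide (a = 1) = decide (b = 1)) : a = b := by
  revert a b; decide

theorem textList_injective {n : ℕ} : Function.Injective (textList (n := n)) := by
  intro x y h
  have := List.ofFn_injective h
  funext i
  exact decide_eq_one_inj (congrFun this i)

theorem hasCommonSubseq_iff {n : ℕ} (x y : Text n) (k : ℕ) : HasCommonSubseq x y k ↔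
    ∃ m : List Bool, m.Sublist (textList x) ∧ m.Sublist (textList y) ∧ m.length = k := by
  constructor
  · rintro ⟨i, j, hi, hj, h⟩
    have key : ∀ (z : Text n) (i : Fin k → Fin n), StrictMono i →
        (List.ofFn fun l => decide (z (i l) = 1)).Sublist (textList z) := by
      intro z i hi
      rw [List.sublist_iff_exists_fin_orderEmbedding_get_eq]
      refine ⟨OrderEmbedding.ofStrictMono
        (fun a => Fin.cast (by simp) (i (Fin.cast (by simp) a))) ?_, ?_⟩
      · intro a b hab
        have : Fin.cast (List.length_ofFn (f := fun l => decide (z (i l) = 1))) a <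
          Fin.cast (List.length_ofFn (f := fun l => decide (z (i l) = 1))) b := hab
        exact hi this
      · intro a
        simp only [textList, List.get_ofFn]
        rfl
    refine ⟨_, key x i hi, ?_, List.length_ofFn⟩
    simp only [h]
    exact key y j hj
  · rintro ⟨m, hx, hy, rfl⟩
    obtain ⟨f, hf⟩ := List.sublist_iff_exists_fin_orderEmbedding_get_eq.1 hx
    obtain ⟨g, hg⟩ := List.sublist_iff_exists_fin_orderEmbedding_get_eq.1 hy
    refine ⟨fun l => Fin.cast (length_textList x) (f l), fun l => Fin.cast (length_textList y) (g l),
      fun a b hab => f.strictMono hab, fun a b hab => g.strictMono hab, fun l => ?_⟩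
    apply decide_eq_one_inj
    have h := (hf l).symm.trans (hg l)
    simp only [textList, List.get_ofFn] at h
    exact h

theorem lcs_eq_listLcs {n : ℕ} (p : TextPair n) :
    lcs p = listLcs (textList p.1) (textList p.2) := by
  simp only [lcs, listLcs, hasCommonSubseq_iff]

theorem flipCount_textList {n : ℕ} (x : Text n) (P : List Bool → Prop) :
    flipCount P (textList x) = ∑ i, (open Classical in
      if x i = 1 ∧ P (textList (Function.update x i 0)) then 1 else 0) := by
  induction n generalizing P with
  | zero => simp [textList, flipCount]
  | succ n ih =>
    rw [Fin.sum_univ_succ, textList_succ, flipCount, ih]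
    congr 1
    · have h1 : Fin.tail (Function.update x 0 0) = Fin.tail x := Fin.tail_update_zero x 0
      have h2 : Function.update x 0 0 0 = (0 : Fin 2) := Function.update_self _ _ _
      rw [textList_succ (Function.update x 0 0), h1, h2]
      congr 1
      exact propext (and_congr_left' decide_eq_true_iff)
    · refine Finset.sum_congr rfl fun i _ => ?_
      have h1 : Fin.tail (Function.update x i.succ 0) = Function.update (Fin.tail x) i 0 :=
        Fin.tail_update_succ x i 0
      have h2 : Function.update x i.succ 0 0 = x 0 :=
        Function.update_of_ne (Fin.succ_ne_zero i).symm _ _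
      rw [textList_succ (Function.update x i.succ 0), h1, h2]
      rfl

theorem flipCount_true_textList {n : ℕ} (x : Text n) :
    (textList x).count true = ∑ i, if x i = 1 then 1 else 0 := by
  rw [← flipCount_eq_count (P := fun _ => True) (fun _ _ => trivial), flipCount_textList]
  simp

/-- The ones whose replacement by a zero changes the length of the longest common subsequence
by `d`. -/
def changingOnes {n : ℕ} (p : TextPair n) (d : ℤ) : Finset (Fin n ⊕ Fin n) :=
  (onePositions p).filter fun s => (lcs (putZero p s) : ℤ) - (lcs p : ℤ) = d

theorem card_onePositions {n : ℕ} (p : TextPair n) : (onePositions p).card =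
    (textList p.1).count true + (textList p.2).count true := by
  rw [flipCount_true_textList, flipCount_true_textList, onePositions, Finset.card_filter,
    Fintype.sum_sum_type]
  rfl

theorem card_changingOnes {n : ℕ} (p : TextPair n) (d : ℤ) : (changingOnes p d).card =
    flipCount (fun l => (listLcs l (textList p.2) : ℤ) -
        listLcs (textList p.1) (textList p.2) = d) (textList p.1) +
      flipCount (fun l => (listLcs (textList p.1) l : ℤ) -
        listLcs (textList p.1) (textList p.2) = d) (textList p.2) := by
  classical
  rw [flipCount_textList, flipCount_textList, changingOnes, onePositions, Finset.filter_filter,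
    Finset.card_filter, Fintype.sum_sum_type]
  simp only [lcs_eq_listLcs, putZero, symbolAt, Sum.elim_inl, Sum.elim_inr]
  congr 1 <;> refine Finset.sum_congr rfl fun i _ => ?_ <;> congr

theorem exists_alignment_of_textPair {n : ℕ} (p : TextPair n) :
    ∃ l, IsAlignment (textList p.1) (textList p.2) l ∧
      (l.map zeroGap).sum ≤ 2 * l.length +
        (((textList p.1).count true - (textList p.2).count true) +
          ((textList p.2).count true - (textList p.1).count true)) ∧
      (∀ s ∈ l, s.1.count false = s.2.count false → NoClosePairs s.1 s.2) ∧
      (l.map fun s => scarceOnes s + scarceOnes s.swap).sum ≤ (changingOnes p 1).card ∧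
      (changingOnes p (-1)).card ≤ 2 * l.length := by
  obtain ⟨l, h1, h2, h3, h4, h5⟩ := exists_good_alignment (textList p.1) (textList p.2)
  have hc : ∀ x : Text n, (textList x).count false + (textList x).count true = n := fun x => by
    rw [List.count_false_add_count_true, length_textList]
  refine ⟨l, h1, ?_, h3, ?_, ?_⟩
  · have := hc p.1
    have := hc p.2
    omega
  · rw [card_changingOnes]
    refine h4.trans_eq ?_
    congr 2 <;> funext l <;> rw [eq_iff_iff] <;> omega
  · rw [card_changingOnes]
    refine le_trans (le_of_eq ?_) h5
    congr 2 <;> funext l <;> rw [eq_iff_iff] <;> omega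

/-! ### Generating functions of lists and segment pairs -/

/-- The union bound in use: each `a` of nonzero weight picks a witness `b`, and `hR` makes the
choice injective. Witnesses are decompositions of lists or, later, alignments. -/
theorem tsum_le_tsum_of_rel {α β : Type*} {f : α → ℝ≥0∞} {g : β → ℝ≥0∞} (R : α → β → Prop)
    (hR : ∀ a a' b, R a b → R a' b → a = a')
    (h : ∀ a, f a ≠ 0 → ∃ b, R a b ∧ f a ≤ g b) : ∑' a, f a ≤ ∑' b, g b := by
  choose φ hφ hle using h
  have hinj : Function.Injective fun a : Function.support f => φ a a.2 := by
    intro a b hab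
    exact Subtype.ext (hR _ _ _ (hφ a a.2) ((show φ a a.2 = φ b b.2 from hab) ▸ hφ b b.2))
  calc ∑' a, f a = ∑' a : Function.support f, f a := (tsum_subtype_support f).symm
    _ ≤ ∑' a : Function.support f, g (φ a a.2) := ENNReal.tsum_le_tsum fun a => hle a a.2
    _ ≤ ∑' b, g b := ENNReal.tsum_comp_le_tsum_of_injective hinj g

theorem tsum_prod_mul {α β : Type*} (f : α → ℝ≥0∞) (g : β → ℝ≥0∞) :
    ∑' p : α × β, f p.1 * g p.2 = (∑' a, f a) * ∑' b, g b := by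
  rw [ENNReal.tsum_prod']
  simp only [ENNReal.tsum_mul_left, ENNReal.tsum_mul_right]

theorem tsum_list_prod_le {α : Type*} (h : α → ℝ≥0∞) :
    ∑' l : List α, (l.map h).prod ≤ (1 - ∑' a, h a)⁻¹ := by
  have key : ∀ k : ℕ, ∑' l : List α, (if l.length = k then (l.map h).prod else 0) ≤
      (∑' a, h a) ^ k := by
    intro k
    induction k with
    | zero =>
      refine (tsum_eq_single [] fun l hl => ?_).trans_le (by simp)
      simp [hl]
    | succ k ih =>
      rw [pow_succ']
      refine le_trans ?_ (mul_le_mul_right ih _)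
      rw [← tsum_prod_mul]
      refine tsum_le_tsum_of_rel (fun l p => l = p.1 :: p.2) (by rintro _ _ _ rfl rfl; rfl) ?_
      intro l hl
      cases l with
      | nil => simp at hl
      | cons a l =>
        refine ⟨(a, l), rfl, ?_⟩
        simp
  calc ∑' l : List α, (l.map h).prod
      ≤ ∑' l : List α, ∑' k : ℕ, (if l.length = k then (l.map h).prod else 0) := by
        refine ENNReal.tsum_le_tsum fun l => ?_
        refine le_trans ?_ (ENNReal.le_tsum l.length)
        simp
    _ = ∑' k : ℕ, ∑' l : List α, (if l.length = k then (l.map h).prod else 0) := ENNReal.tsum_comm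
    _ ≤ ∑' k : ℕ, (∑' a, h a) ^ k := ENNReal.tsum_le_tsum key
    _ = (1 - ∑' a, h a)⁻¹ := ENNReal.tsum_geometric _

/-- Weight of a list, each `false` having weight `w₀` and each `true` having weight `w₁`. -/
def listWeight (w₀ w₁ : ℝ≥0∞) (x : List Bool) : ℝ≥0∞ :=
  w₀ ^ x.count false * w₁ ^ x.count true

theorem listWeight_append (w₀ w₁ : ℝ≥0∞) (x y : List Bool) :
    listWeight w₀ w₁ (x ++ y) = listWeight w₀ w₁ x * listWeight w₀ w₁ y := by
  simp only [listWeight, List.count_append, pow_add]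
  ring

@[simp] theorem listWeight_false_cons (w₀ w₁ : ℝ≥0∞) (x : List Bool) :
    listWeight w₀ w₁ (false :: x) = w₀ * listWeight w₀ w₁ x := by
  simp [listWeight, pow_succ]
  ring

@[simp] theorem listWeight_true_cons (w₀ w₁ : ℝ≥0∞) (x : List Bool) :
    listWeight w₀ w₁ (true :: x) = w₁ * listWeight w₀ w₁ x := by
  simp [listWeight, pow_succ]
  ring

@[simp] theorem listWeight_replicate_true (w₀ w₁ : ℝ≥0∞) (g : ℕ) :
    listWeight w₀ w₁ (List.replicate g true) = w₁ ^ g := by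
  simp [listWeight, List.count_replicate]

theorem exists_eq_replicate_append (x : List Bool) :
    (∃ g, x = List.replicate g true) ∨ ∃ g y, x = List.replicate g true ++ false :: y := by
  induction x with
  | nil => exact Or.inl ⟨0, rfl⟩
  | cons b x ih =>
    cases b with
    | false => exact Or.inr ⟨0, x, rfl⟩
    | true =>
      rcases ih with ⟨g, rfl⟩ | ⟨g, y, rfl⟩
      · exact Or.inl ⟨g + 1, rfl⟩
      · exact Or.inr ⟨g + 1, y, rfl⟩

theorem exists_of_count_false_succ {x : List Bool} {k : ℕ} (h : x.count false = k + 1) :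
    ∃ g y, x = List.replicate g true ++ false :: y ∧ y.count false = k := by
  rcases exists_eq_replicate_append x with ⟨g, rfl⟩ | ⟨g, y, rfl⟩
  · simp [List.count_replicate] at h
  · exact ⟨g, y, rfl, by simpa [List.count_replicate] using h⟩

/-- The `k` zeros leave `k + 1` gaps, each filled with a run of ones of arbitrary length. -/
theorem tsum_listWeight_le (w₀ w₁ : ℝ≥0∞) (k : ℕ) :
    ∑' x : List Bool, (if x.count false = k then listWeight w₀ w₁ x else 0) ≤
      w₀ ^ k * (1 - w₁)⁻¹ ^ (k + 1) := by
  rw [← ENNReal.tsum_geometric]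
  induction k with
  | zero =>
    rw [pow_zero, one_mul, zero_add, pow_one]
    refine tsum_le_tsum_of_rel (fun x g => x = List.replicate g true)
      (by rintro _ _ _ rfl rfl; rfl) ?_
    intro x hx
    rcases exists_eq_replicate_append x with ⟨g, rfl⟩ | ⟨g, y, rfl⟩
    · exact ⟨g, rfl, by simp [List.count_replicate]⟩
    · simp at hx
  | succ k ih =>
    refine le_trans ?_ (le_of_le_of_eq (mul_le_mul_right ih ((∑' g : ℕ, w₁ ^ g) * w₀)) (by ring))
    rw [← ENNReal.tsum_mul_right, ← tsum_prod_mul]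
    refine tsum_le_tsum_of_rel (fun x p => x = List.replicate p.1 true ++ false :: p.2)
      (by rintro _ _ _ rfl rfl; rfl) ?_
    intro x hx
    have hk : x.count false = k + 1 := by
      by_contra h
      simp [h] at hx
    obtain ⟨g, y, rfl, hy⟩ := exists_of_count_false_succ hk
    refine ⟨(g, y), rfl, ?_⟩
    simp [hy, hk, listWeight_append, mul_assoc]

theorem tsum_pair_le (v₀ v₁ w₀ w₁ : ℝ≥0∞) (k l : ℕ) :
    ∑' s : SegPair, (if s.1.count false = k ∧ s.2.count false = l then
      listWeight v₀ v₁ s.1 * listWeight w₀ w₁ s.2 else 0) ≤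
      (v₀ ^ k * (1 - v₁)⁻¹ ^ (k + 1)) * (w₀ ^ l * (1 - w₁)⁻¹ ^ (l + 1)) := by
  refine le_trans (le_of_eq ?_)
    (mul_le_mul' (tsum_listWeight_le v₀ v₁ k) (tsum_listWeight_le w₀ w₁ l))
  rw [← tsum_prod_mul]
  refine tsum_congr fun s => ?_
  by_cases h1 : s.1.count false = k <;> by_cases h2 : s.2.count false = l <;> simp [h1, h2]

theorem tsum_equal_zeros_le (w₀ w₁ : ℝ≥0∞) :
    ∑' s : SegPair, (if s.1.count false = s.2.count false then
      listWeight w₀ w₁ s.1 * listWeight w₀ w₁ s.2 else 0) ≤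
      (1 - w₁)⁻¹ ^ 2 * (1 - (w₀ * (1 - w₁)⁻¹) ^ 2)⁻¹ := by
  calc _ ≤ ∑' s : SegPair, ∑' k : ℕ, (if s.1.count false = k ∧ s.2.count false = k then
        listWeight w₀ w₁ s.1 * listWeight w₀ w₁ s.2 else 0) := by
        refine ENNReal.tsum_le_tsum fun s => ?_
        refine le_trans ?_ (ENNReal.le_tsum (s.2.count false))
        simp
    _ ≤ ∑' k : ℕ, (1 - w₁)⁻¹ ^ 2 * ((w₀ * (1 - w₁)⁻¹) ^ 2) ^ k := by
        rw [ENNReal.tsum_comm]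
        refine ENNReal.tsum_le_tsum fun k => (tsum_pair_le w₀ w₁ w₀ w₁ k k).trans_eq ?_
        ring
    _ = _ := by rw [ENNReal.tsum_mul_left, ENNReal.tsum_geometric]

/-- The factor `q` merely changes the weight of a one in the first segment to `q * w₁`. The sum then
runs over the zero count `p.1` of the first segment and the gap `p.2 + 1`, two geometric series. -/
theorem tsum_fewer_zeros_le (w₀ w₁ q t : ℝ≥0∞) :
    ∑' s : SegPair, (if s.1.count false < s.2.count false then
      listWeight w₀ w₁ s.1 * listWeight w₀ w₁ s.2 * (t ^ zeroGap s * q ^ s.1.count true) else 0) ≤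
      (1 - q * w₁)⁻¹ * (1 - w₁)⁻¹ *
        (1 - (w₀ * (1 - q * w₁)⁻¹) * (w₀ * (1 - w₁)⁻¹))⁻¹ *
        (t * (w₀ * (1 - w₁)⁻¹) * (1 - t * (w₀ * (1 - w₁)⁻¹))⁻¹) := by
  calc _ ≤ ∑' s : SegPair, ∑' p : ℕ × ℕ,
        (if s.1.count false = p.1 ∧ s.2.count false = p.1 + p.2 + 1 then
        listWeight w₀ (q * w₁) s.1 * listWeight w₀ w₁ s.2 else 0) * t ^ (p.2 + 1) := by
        refine ENNReal.tsum_le_tsum fun s => ?_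
        refine le_trans ?_ (ENNReal.le_tsum
          (s.1.count false, s.2.count false - s.1.count false - 1))
        split_ifs with h1 h2
        · have h3 : zeroGap s = s.2.count false - s.1.count false - 1 + 1 := by
            unfold zeroGap; omega
          rw [h3]
          simp only [listWeight, mul_pow]
          exact le_of_eq (by ring)
        · exact absurd ⟨rfl, by omega⟩ h2
        · exact zero_le
        · exact zero_le
    _ ≤ ∑' p : ℕ × ℕ, ((w₀ ^ p.1 * (1 - q * w₁)⁻¹ ^ (p.1 + 1)) *
          (w₀ ^ (p.1 + p.2 + 1) * (1 - w₁)⁻¹ ^ (p.1 + p.2 + 1 + 1))) * t ^ (p.2 + 1) := by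
        rw [ENNReal.tsum_comm]
        refine ENNReal.tsum_le_tsum fun p => ?_
        rw [ENNReal.tsum_mul_right]
        exact mul_le_mul_left (tsum_pair_le _ _ _ _ _ _) _
    _ = ∑' p : ℕ × ℕ, ((1 - q * w₁)⁻¹ * (1 - w₁)⁻¹ *
          ((w₀ * (1 - q * w₁)⁻¹) * (w₀ * (1 - w₁)⁻¹)) ^ p.1) *
          (t * (w₀ * (1 - w₁)⁻¹) * (t * (w₀ * (1 - w₁)⁻¹)) ^ p.2) := by
        refine tsum_congr fun p => ?_
        ring
    _ = _ := by
        rw [tsum_prod_mul (fun k : ℕ => (1 - q * w₁)⁻¹ * (1 - w₁)⁻¹ *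
          ((w₀ * (1 - q * w₁)⁻¹) * (w₀ * (1 - w₁)⁻¹)) ^ k) (fun m : ℕ =>
          t * (w₀ * (1 - w₁)⁻¹) * (t * (w₀ * (1 - w₁)⁻¹)) ^ m), ENNReal.tsum_mul_left,
          ENNReal.tsum_mul_left, ENNReal.tsum_geometric, ENNReal.tsum_geometric]

theorem tsum_pow_of_ne_zero (w : ℝ≥0∞) :
    ∑' n : ℕ, (if n = 0 then 0 else w ^ n) = w * (1 - w)⁻¹ := by
  rw [tsum_eq_zero_add' ENNReal.summable, ← ENNReal.tsum_geometric, ← ENNReal.tsum_mul_left]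
  simp [pow_succ']

theorem tsum_pow_pair_of_ne_zero_le (w : ℝ≥0∞) :
    ∑' g : ℕ × ℕ, (if g = 0 then 0 else w ^ (g.1 + g.2)) ≤
      w * (1 - w)⁻¹ * (1 - w)⁻¹ + w * (1 - w)⁻¹ := by
  calc _ ≤ ∑' g : ℕ × ℕ, ((if g.1 = 0 then 0 else w ^ g.1) * w ^ g.2 +
        (if g.1 = 0 then 1 else 0) * (if g.2 = 0 then 0 else w ^ g.2)) := by
        refine ENNReal.tsum_le_tsum fun g => ?_
        obtain ⟨a, b⟩ := g
        by_cases ha : a = 0 <;> by_cases hb : b = 0 <;> simp [ha, hb, pow_add]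
    _ = _ := by
        rw [ENNReal.tsum_add, tsum_prod_mul (fun a : ℕ => if a = 0 then 0 else w ^ a)
          (fun b : ℕ => w ^ b), tsum_prod_mul (fun a : ℕ => if a = 0 then (1 : ℝ≥0∞) else 0)
          (fun b : ℕ => if b = 0 then 0 else w ^ b), tsum_pow_of_ne_zero, ENNReal.tsum_geometric,
          tsum_ite_eq, one_mul]

/-! ### Segment pairs without close ones -/

/-- Total weight of a pair of cells (two gaps followed by a zero each, in both strings), at most
one of which contains a one. -/
def cellWeight (w₀ w₁ : ℝ≥0∞) : ℝ≥0∞ :=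
  w₀ ^ 4 * ((1 - w₁)⁻¹ * (1 - w₁)⁻¹ + (w₁ * (1 - w₁)⁻¹ * (1 - w₁)⁻¹ + w₁ * (1 - w₁)⁻¹))

theorem tsum_cell_le (w₀ w₁ : ℝ≥0∞) :
    ∑' p : (ℕ × ℕ) × (ℕ × ℕ), (if p.1 = 0 ∨ p.2 = 0 then
      w₀ ^ 4 * (w₁ ^ (p.1.1 + p.1.2) * w₁ ^ (p.2.1 + p.2.2)) else 0) ≤ cellWeight w₀ w₁ := by
  calc _ ≤ ∑' p : (ℕ × ℕ) × (ℕ × ℕ), w₀ ^ 4 *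
        ((if p.1 = 0 then 1 else 0) * (w₁ ^ p.2.1 * w₁ ^ p.2.2) +
        (if p.1 = 0 then 0 else w₁ ^ (p.1.1 + p.1.2)) * (if p.2 = 0 then 1 else 0)) := by
        refine ENNReal.tsum_le_tsum fun p => ?_
        obtain ⟨a, b⟩ := p
        by_cases ha : a = 0 <;> by_cases hb : b = 0 <;> simp [ha, hb, pow_add]
    _ ≤ _ := by
        rw [ENNReal.tsum_mul_left, ENNReal.tsum_add,
          tsum_prod_mul (fun a : ℕ × ℕ => if a = 0 then (1 : ℝ≥0∞) else 0)
          (fun b : ℕ × ℕ => w₁ ^ b.1 * w₁ ^ b.2),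
          tsum_prod_mul (fun a : ℕ × ℕ => if a = 0 then 0 else w₁ ^ (a.1 + a.2))
          (fun b : ℕ × ℕ => if b = 0 then (1 : ℝ≥0∞) else 0), tsum_ite_eq,
          tsum_prod_mul (fun b : ℕ => w₁ ^ b) (fun b : ℕ => w₁ ^ b), ENNReal.tsum_geometric,
          one_mul, mul_one]
        exact mul_le_mul_right (add_le_add_right (tsum_pow_pair_of_ne_zero_le w₁) _) _

/-- Two gaps of lengths `g.1` and `g.2`, each followed by a zero. -/
def cell (g : ℕ × ℕ) : List Bool :=
  List.replicate g.1 true ++ false :: (List.replicate g.2 true ++ [false])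

theorem exists_of_count_false_add_two {x : List Bool} {k : ℕ} (h : x.count false = k + 2) :
    ∃ g y, x = cell g ++ y ∧ y.count false = k := by
  obtain ⟨a, y, rfl, hy⟩ := exists_of_count_false_succ h
  obtain ⟨b, z, rfl, hz⟩ := exists_of_count_false_succ hy
  exact ⟨(a, b), z, by simp [cell], hz⟩

theorem count_false_cell (g : ℕ × ℕ) : (cell g).count false = 2 := by
  simp [cell, List.count_replicate]

theorem listWeight_cell (w₀ w₁ : ℝ≥0∞) (g : ℕ × ℕ) :
    listWeight w₀ w₁ (cell g) = w₀ ^ 2 * w₁ ^ (g.1 + g.2) := by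
  simp [cell, listWeight, List.count_replicate]

theorem cell_eq_of_ne_zero {g : ℕ × ℕ} (hg : g ≠ 0) :
    ∃ a b, cell g = a ++ true :: b ∧ a.count false ≤ 1 := by
  obtain ⟨m, k⟩ := g
  cases m with
  | succ m => exact ⟨[], _, rfl, by simp⟩
  | zero =>
    cases k with
    | zero => exact absurd rfl hg
    | succ k => exact ⟨[false], _, rfl, by simp⟩

/-- A one in the leading cell has at most one zero before it, so ones in both leading cells would be
close. Cells contain two zeros to exploit the tolerance `1` fully: each pair of cells then loses
about `4 * ε ^ 2`. One-zero cells would lose only `ε ^ 2` per zero and give a step weight of about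
`1`, leaving no room. -/
theorem NoClosePairs.cell_eq_zero {g h : ℕ × ℕ} {x y : List Bool}
    (H : NoClosePairs (cell g ++ x) (cell h ++ y)) : g = 0 ∨ h = 0 := by
  by_contra! hne
  obtain ⟨a, b, hab, ha⟩ := cell_eq_of_ne_zero hne.1
  obtain ⟨c, d, hcd, hc⟩ := cell_eq_of_ne_zero hne.2
  exact H a (b ++ x) c (d ++ y) (by simp [hab]) (by simp [hcd]) (by omega) (by omega)

theorem NoClosePairs.of_cell_append {g h : ℕ × ℕ} {x y : List Bool}
    (H : NoClosePairs (cell g ++ x) (cell h ++ y)) : NoClosePairs x y := by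
  intro a b c d hx hy h1 h2
  refine H (cell g ++ a) b (cell h ++ c) d (by simp [hx]) (by simp [hy]) ?_ ?_ <;>
    simp only [List.count_append, count_false_cell] <;> omega

/-- Weight of a pair of segments with `k` zeros each and without close pairs of ones. -/
def noCloseWeight (w₀ w₁ : ℝ≥0∞) (k : ℕ) (s : SegPair) : ℝ≥0∞ :=
  open Classical in
  if s.1.count false = k ∧ s.2.count false = k ∧ NoClosePairs s.1 s.2 then
    listWeight w₀ w₁ s.1 * listWeight w₀ w₁ s.2 else 0

theorem tsum_noCloseWeight_add_two_le (w₀ w₁ : ℝ≥0∞) (k : ℕ) :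
    ∑' s, noCloseWeight w₀ w₁ (k + 2) s ≤ cellWeight w₀ w₁ * ∑' s, noCloseWeight w₀ w₁ k s := by
  refine le_trans ?_ (mul_le_mul_left (tsum_cell_le w₀ w₁) _)
  rw [← tsum_prod_mul]
  refine tsum_le_tsum_of_rel (fun s p => s = (cell p.1.1 ++ p.2.1, cell p.1.2 ++ p.2.2))
    (by rintro _ _ _ rfl rfl; rfl) ?_
  rintro ⟨x, y⟩ hs
  have h : x.count false = k + 2 ∧ y.count false = k + 2 ∧ NoClosePairs x y := by
    by_contra h
    simp [noCloseWeight, h] at hs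
  obtain ⟨g, x', rfl, hx⟩ := exists_of_count_false_add_two h.1
  obtain ⟨g', y', rfl, hy⟩ := exists_of_count_false_add_two h.2.1
  refine ⟨((g, g'), (x', y')), rfl, ?_⟩
  simp only [noCloseWeight]
  rw [if_pos h, if_pos h.2.2.cell_eq_zero, if_pos ⟨hx, hy, h.2.2.of_cell_append⟩,
    listWeight_append, listWeight_append, listWeight_cell, listWeight_cell]
  exact le_of_eq (by ring)

/-- Peeling off cells leaves zero or one zero, according to parity; these two remainders give the
first factor and the cells a geometric series. -/
theorem tsum_noClosePairs_le (w₀ w₁ : ℝ≥0∞) :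
    ∑' s : SegPair, (open Classical in
      if s.1.count false = s.2.count false ∧ NoClosePairs s.1 s.2 then
      listWeight w₀ w₁ s.1 * listWeight w₀ w₁ s.2 else 0) ≤
      ((1 - w₁)⁻¹ ^ 2 + w₀ ^ 2 * (1 - w₁)⁻¹ ^ 4) * (1 - cellWeight w₀ w₁)⁻¹ := by
  have h0 : ∀ k, ∑' s, noCloseWeight w₀ w₁ k s ≤
      (w₀ ^ k * (1 - w₁)⁻¹ ^ (k + 1)) * (w₀ ^ k * (1 - w₁)⁻¹ ^ (k + 1)) := fun k => by
    refine le_trans (ENNReal.tsum_le_tsum fun s => ?_) (tsum_pair_le w₀ w₁ w₀ w₁ k k)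
    unfold noCloseWeight
    split_ifs with h1 h2 <;> simp_all
  have h2 : ∀ j k, ∑' s, noCloseWeight w₀ w₁ (2 * j + k) s ≤
      cellWeight w₀ w₁ ^ j * ∑' s, noCloseWeight w₀ w₁ k s := fun j k => by
    induction j with
    | zero => simp
    | succ j ih =>
      rw [show 2 * (j + 1) + k = 2 * j + k + 2 by ring, pow_succ', mul_assoc]
      exact (tsum_noCloseWeight_add_two_le _ _ _).trans (mul_le_mul_right ih _)
  calc _ ≤ ∑' s : SegPair, ∑' j : ℕ,
        (noCloseWeight w₀ w₁ (2 * j + 0) s + noCloseWeight w₀ w₁ (2 * j + 1) s) := by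
        refine ENNReal.tsum_le_tsum fun s => ?_
        refine le_trans ?_ (ENNReal.le_tsum (s.1.count false / 2))
        split_ifs with h
        · rcases Nat.even_or_odd' (s.1.count false) with ⟨j, hj | hj⟩
          · have h3 : s.1.count false / 2 = j := by omega
            refine le_trans ?_ le_self_add
            unfold noCloseWeight
            rw [if_pos ⟨by omega, by omega, h.2⟩]
          · have h3 : s.1.count false / 2 = j := by omega
            refine le_trans ?_ le_add_self
            unfold noCloseWeight
            rw [if_pos ⟨by omega, by omega, h.2⟩]
        · exact zero_le
    _ ≤ ∑' j : ℕ, cellWeight w₀ w₁ ^ j * ((1 - w₁)⁻¹ ^ 2 + w₀ ^ 2 * (1 - w₁)⁻¹ ^ 4) := by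
        rw [ENNReal.tsum_comm]
        refine ENNReal.tsum_le_tsum fun j => ?_
        rw [ENNReal.tsum_add, mul_add]
        refine add_le_add ((h2 j 0).trans (mul_le_mul_right ((h0 0).trans_eq ?_) _))
          ((h2 j 1).trans (mul_le_mul_right ((h0 1).trans_eq ?_) _)) <;> ring
    _ = _ := by rw [ENNReal.tsum_mul_right, ENNReal.tsum_geometric, mul_comm]

/-! ### Weights of alignments and the first moment -/

/-- Weight of a pair of segments of an alignment: `t` for each unmatched zero, `q` for each one
in the segment with fewer zeros; segments with equally many zeros must satisfy `V`. -/
def segWeight (V : SegPair → Prop) (t q : ℝ≥0∞) (s : SegPair) : ℝ≥0∞ :=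
  open Classical in
  if s.1.count false = s.2.count false then (if V s then 1 else 0)
  else t ^ zeroGap s * q ^ (scarceOnes s + scarceOnes s.swap)

theorem zeroGap_swap (s : SegPair) : zeroGap s.swap = zeroGap s := by
  simp [zeroGap, add_comm]

theorem tsum_segWeight_le (V : SegPair → Prop) (w₀ w₁ t q : ℝ≥0∞) :
    ∑' s : SegPair, listWeight w₀ w₁ s.1 * listWeight w₀ w₁ s.2 * segWeight V t q s ≤
      ∑' s : SegPair, (open Classical in
        if s.1.count false = s.2.count false ∧ V s then
          listWeight w₀ w₁ s.1 * listWeight w₀ w₁ s.2 else 0) +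
      2 * ((1 - q * w₁)⁻¹ * (1 - w₁)⁻¹ *
        (1 - (w₀ * (1 - q * w₁)⁻¹) * (w₀ * (1 - w₁)⁻¹))⁻¹ *
        (t * (w₀ * (1 - w₁)⁻¹) * (1 - t * (w₀ * (1 - w₁)⁻¹))⁻¹)) := by
  classical
  set G : SegPair → ℝ≥0∞ := fun s => if s.1.count false < s.2.count false then
      listWeight w₀ w₁ s.1 * listWeight w₀ w₁ s.2 * (t ^ zeroGap s * q ^ s.1.count true) else 0
    with hG
  have h1 : ∑' s : SegPair, G s.swap = ∑' s, G s := (Equiv.prodComm _ _).tsum_eq G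
  have h2 := tsum_fewer_zeros_le w₀ w₁ q t
  calc _ ≤ ∑' s : SegPair, ((if s.1.count false = s.2.count false ∧ V s then
          listWeight w₀ w₁ s.1 * listWeight w₀ w₁ s.2 else 0) + (G s + G s.swap)) := by
        refine ENNReal.tsum_le_tsum fun s => ?_
        rcases lt_trichotomy (s.1.count false) (s.2.count false) with h | h | h
        · simp [segWeight, hG, h, h.ne, scarceOnes, h.not_gt]
        · by_cases hV : V s <;> simp [segWeight, hG, h, hV]
        · simp only [segWeight, hG, h, h.ne', scarceOnes, h.not_gt, zeroGap_swap, Prod.fst_swap,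
            Prod.snd_swap, if_true, if_false, zero_add, false_and]
          exact le_of_eq (by ring)
    _ ≤ _ := by
        rw [ENNReal.tsum_add, ENNReal.tsum_add, h1, ← two_mul]
        exact add_le_add_right (mul_le_mul_right h2 2) _

theorem listWeight_joinOnes (w₀ w₁ : ℝ≥0∞) (π : SegPair → List Bool) (l : List SegPair) :
    listWeight w₀ w₁ (joinOnes π l) = (l.map fun s => w₁ * listWeight w₀ w₁ (π s)).prod := by
  induction l with
  | nil => simp [listWeight]
  | cons s t ih => simp [listWeight_append, ih, mul_assoc]

/-- The first moment bound: if every pair in `S` has an alignment of weight at least `a`,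
then `S` has small total weight. -/
theorem sum_listWeight_le {n : ℕ} (S : Finset (TextPair n)) (w₀ w₁ κ a : ℝ≥0∞)
    (f : SegPair → ℝ≥0∞)
    (h : ∀ p ∈ S, ∃ l, IsAlignment (textList p.1) (textList p.2) l ∧
      a ≤ (l.map fun s => κ * f s).prod) :
    a * w₁ ^ 2 * ∑ p ∈ S, listWeight w₀ w₁ (textList p.1) * listWeight w₀ w₁ (textList p.2) ≤
      (1 - κ * w₁ ^ 2 *
        ∑' s : SegPair, listWeight w₀ w₁ s.1 * listWeight w₀ w₁ s.2 * f s)⁻¹ := by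
  rw [← ENNReal.tsum_mul_left]
  refine le_trans ?_ (tsum_list_prod_le _)
  rw [← Finset.tsum_subtype, ← ENNReal.tsum_mul_left]
  refine tsum_le_tsum_of_rel
    (fun p l => IsAlignment (textList p.1.1) (textList p.1.2) l) ?_ ?_
  -- An alignment determines both strings, so different pairs have different alignments.
  · intro p p' l h1 h2
    refine Subtype.ext (Prod.ext (textList_injective ?_) (textList_injective ?_))
    · exact (List.cons.inj (h1.1.symm.trans h2.1)).2
    · exact (List.cons.inj (h1.2.symm.trans h2.2)).2
  · rintro ⟨p, hp⟩ -
    obtain ⟨l, hl, ha⟩ := h p hp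
    refine ⟨l, hl, ?_⟩
    calc _ = a * (listWeight w₀ w₁ (true :: textList p.1) *
          listWeight w₀ w₁ (true :: textList p.2)) := by
          simp only [listWeight_true_cons]
          ring
      _ ≤ (l.map fun s => κ * f s).prod * (listWeight w₀ w₁ (true :: textList p.1) *
          listWeight w₀ w₁ (true :: textList p.2)) := mul_le_mul_left ha _
      _ = _ := by
          rw [← hl.1, ← hl.2, listWeight_joinOnes, listWeight_joinOnes, ← List.prod_map_mul,
            ← List.prod_map_mul]
          congr 1
          refine List.map_congr_left fun s _ => ?_
          ring

/-! ### Numerical bounds for the step weight -/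

theorem one_sub_ofReal_inv {x : ℝ} (h0 : 0 ≤ x) (h1 : x < 1) :
    (1 - ENNReal.ofReal x)⁻¹ = ENNReal.ofReal (1 - x)⁻¹ := by
  rw [← ENNReal.ofReal_one, ← ENNReal.ofReal_sub _ h0, ENNReal.ofReal_inv_of_pos (by linarith)]


/-- Real version of `cellWeight`. -/
def realCellWeight (v w : ℝ) : ℝ :=
  v ^ 4 * ((1 - w)⁻¹ * (1 - w)⁻¹ + (w * (1 - w)⁻¹ * (1 - w)⁻¹ + w * (1 - w)⁻¹))

theorem cellWeight_ofReal {v w : ℝ} (hv : 0 ≤ v) (hw : 0 ≤ w) (hw1 : w < 1) :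
    cellWeight (ENNReal.ofReal v) (ENNReal.ofReal w) = ENNReal.ofReal (realCellWeight v w) := by
  have hui : 0 ≤ (1 - w)⁻¹ := by rw [inv_nonneg]; linarith
  rw [cellWeight, realCellWeight, one_sub_ofReal_inv hw hw1, ← ENNReal.ofReal_pow hv,
    ← ENNReal.ofReal_mul hui, ← ENNReal.ofReal_mul hw,
    ← ENNReal.ofReal_mul (by positivity), ← ENNReal.ofReal_add (by positivity) (by positivity),
    ← ENNReal.ofReal_add (by positivity) (by positivity), ← ENNReal.ofReal_mul (by positivity)]

/-- Bound for the total weight of the pairs of segments in which the first one has fewer zeros. -/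
def unequalWeight (v w t q : ℝ) : ℝ :=
  (1 - q * w)⁻¹ * (1 - w)⁻¹ * (1 - (v * (1 - q * w)⁻¹) * (v * (1 - w)⁻¹))⁻¹ *
    (t * (v * (1 - w)⁻¹) * (1 - t * (v * (1 - w)⁻¹))⁻¹)

theorem unequalWeight_nonneg {v w t q : ℝ} (hv : 0 ≤ v) (hw1 : w < 1)
    (ht : 0 ≤ t) (hqw : q * w < 1) (hg : (v * (1 - q * w)⁻¹) * (v * (1 - w)⁻¹) < 1)
    (htρ : t * (v * (1 - w)⁻¹) < 1) : 0 ≤ unequalWeight v w t q := by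
  have hui : 0 ≤ (1 - w)⁻¹ := by rw [inv_nonneg]; linarith
  have hri : 0 ≤ (1 - q * w)⁻¹ := by rw [inv_nonneg]; linarith
  have hg2 : 0 ≤ (1 - (v * (1 - q * w)⁻¹) * (v * (1 - w)⁻¹))⁻¹ := by rw [inv_nonneg]; linarith
  have ht2 : 0 ≤ (1 - t * (v * (1 - w)⁻¹))⁻¹ := by rw [inv_nonneg]; linarith
  unfold unequalWeight
  positivity

theorem unequalWeight_ofReal {v w t q : ℝ} (hv : 0 ≤ v) (hw : 0 ≤ w) (hw1 : w < 1)
    (ht : 0 ≤ t) (hq : 0 ≤ q) (hqw : q * w < 1)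
    (hg : (v * (1 - q * w)⁻¹) * (v * (1 - w)⁻¹) < 1) (htρ : t * (v * (1 - w)⁻¹) < 1) :
    (1 - ENNReal.ofReal q * ENNReal.ofReal w)⁻¹ * (1 - ENNReal.ofReal w)⁻¹ *
      (1 - (ENNReal.ofReal v * (1 - ENNReal.ofReal q * ENNReal.ofReal w)⁻¹) *
        (ENNReal.ofReal v * (1 - ENNReal.ofReal w)⁻¹))⁻¹ *
      (ENNReal.ofReal t * (ENNReal.ofReal v * (1 - ENNReal.ofReal w)⁻¹) *
        (1 - ENNReal.ofReal t * (ENNReal.ofReal v * (1 - ENNReal.ofReal w)⁻¹))⁻¹) =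
      ENNReal.ofReal (unequalWeight v w t q) := by
  have hui : 0 ≤ (1 - w)⁻¹ := by rw [inv_nonneg]; linarith
  have hri : 0 ≤ (1 - q * w)⁻¹ := by rw [inv_nonneg]; linarith
  have hg2 : 0 ≤ (1 - (v * (1 - q * w)⁻¹) * (v * (1 - w)⁻¹))⁻¹ := by rw [inv_nonneg]; linarith
  have ht2 : 0 ≤ (1 - t * (v * (1 - w)⁻¹))⁻¹ := by rw [inv_nonneg]; linarith
  have hqw0 : 0 ≤ q * w := by positivity
  rw [unequalWeight, ← ENNReal.ofReal_mul hq, one_sub_ofReal_inv hw hw1,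
    one_sub_ofReal_inv hqw0 hqw, ← ENNReal.ofReal_mul hv, ← ENNReal.ofReal_mul hv,
    ← ENNReal.ofReal_mul (p := v * (1 - q * w)⁻¹) (by positivity),
    one_sub_ofReal_inv (by positivity) hg, ← ENNReal.ofReal_mul ht,
    one_sub_ofReal_inv (by positivity) htρ, ← ENNReal.ofReal_mul hri,
    ← ENNReal.ofReal_mul (by positivity), ← ENNReal.ofReal_mul (by positivity),
    ← ENNReal.ofReal_mul (by positivity)]

theorem stepWeight_noClosePairs_le {v w t q κ : ℝ} (hv : 0 ≤ v) (hw : 0 ≤ w) (hw1 : w < 1)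
    (ht : 0 ≤ t) (hq : 0 ≤ q) (hκ : 0 ≤ κ) (hqw : q * w < 1)
    (hg : (v * (1 - q * w)⁻¹) * (v * (1 - w)⁻¹) < 1) (htρ : t * (v * (1 - w)⁻¹) < 1)
    (hA0 : 0 ≤ realCellWeight v w) (hA : realCellWeight v w < 1) :
    ENNReal.ofReal κ * ENNReal.ofReal w ^ 2 * ∑' s : SegPair,
        listWeight (ENNReal.ofReal v) (ENNReal.ofReal w) s.1 *
        listWeight (ENNReal.ofReal v) (ENNReal.ofReal w) s.2 *
        segWeight (fun s => NoClosePairs s.1 s.2) (ENNReal.ofReal t) (ENNReal.ofReal q) s ≤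
      ENNReal.ofReal (κ * w ^ 2 * (((1 - w)⁻¹ ^ 2 + v ^ 2 * (1 - w)⁻¹ ^ 4) *
        (1 - realCellWeight v w)⁻¹ + 2 * unequalWeight v w t q)) := by
  have hui : 0 ≤ (1 - w)⁻¹ := by rw [inv_nonneg]; linarith
  have hA2 : 0 ≤ (1 - realCellWeight v w)⁻¹ := by rw [inv_nonneg]; linarith
  have hU := unequalWeight_nonneg hv hw1 ht hqw hg htρ
  refine le_trans (mul_le_mul_right (tsum_segWeight_le _ _ _ _ _) _) ?_
  refine le_trans (mul_le_mul_right (add_le_add_left (tsum_noClosePairs_le _ _) _) _) ?_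
  rw [unequalWeight_ofReal hv hw hw1 ht hq hqw hg htρ, cellWeight_ofReal hv hw hw1,
    one_sub_ofReal_inv hw hw1, one_sub_ofReal_inv hA0 hA, ← ENNReal.ofReal_pow hv,
    ← ENNReal.ofReal_pow hui, ← ENNReal.ofReal_pow hui,
    ← ENNReal.ofReal_mul (by positivity), ← ENNReal.ofReal_add (by positivity) (by positivity),
    ← ENNReal.ofReal_mul (by positivity),
    show (2 : ℝ≥0∞) = ENNReal.ofReal 2 by simp, ← ENNReal.ofReal_mul (by positivity),
    ← ENNReal.ofReal_add (by positivity) (by positivity), ← ENNReal.ofReal_pow hw,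
    ← ENNReal.ofReal_mul hκ, ← ENNReal.ofReal_mul (by positivity)]

theorem stepWeight_true_le {v w t κ : ℝ} (hv : 0 ≤ v) (hw : 0 ≤ w) (hw1 : w < 1)
    (ht : 0 ≤ t) (hκ : 0 ≤ κ)
    (hg : (v * (1 - w)⁻¹) ^ 2 < 1) (htρ : t * (v * (1 - w)⁻¹) < 1) :
    ENNReal.ofReal κ * ENNReal.ofReal w ^ 2 * ∑' s : SegPair,
        listWeight (ENNReal.ofReal v) (ENNReal.ofReal w) s.1 *
        listWeight (ENNReal.ofReal v) (ENNReal.ofReal w) s.2 *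
        segWeight (fun _ => True) (ENNReal.ofReal t) (ENNReal.ofReal 1) s ≤
      ENNReal.ofReal (κ * w ^ 2 * ((1 - w)⁻¹ ^ 2 * (1 - (v * (1 - w)⁻¹) ^ 2)⁻¹ +
        2 * unequalWeight v w t 1)) := by
  have hui : 0 ≤ (1 - w)⁻¹ := by rw [inv_nonneg]; linarith
  have hG2 : 0 ≤ (1 - (v * (1 - w)⁻¹) ^ 2)⁻¹ := by rw [inv_nonneg]; linarith
  have hqw : 1 * w < 1 := by linarith
  have hg' : (v * (1 - 1 * w)⁻¹) * (v * (1 - w)⁻¹) < 1 := by rwa [one_mul, ← sq]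
  have hU := unequalWeight_nonneg hv hw1 ht hqw hg' htρ
  refine le_trans (mul_le_mul_right (tsum_segWeight_le _ _ _ _ _) _) ?_
  simp only [and_true]
  refine le_trans (mul_le_mul_right (add_le_add_left (tsum_equal_zeros_le _ _) _) _) ?_
  rw [unequalWeight_ofReal hv hw hw1 ht zero_le_one hqw hg' htρ,
    one_sub_ofReal_inv hw hw1, ← ENNReal.ofReal_mul hv,
    ← ENNReal.ofReal_pow (p := v * (1 - w)⁻¹) (by positivity),
    one_sub_ofReal_inv (by positivity) hg, ← ENNReal.ofReal_pow hui,
    ← ENNReal.ofReal_mul (by positivity),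
    show (2 : ℝ≥0∞) = ENNReal.ofReal 2 by simp, ← ENNReal.ofReal_mul (by positivity),
    ← ENNReal.ofReal_add (by positivity) (by positivity), ← ENNReal.ofReal_pow hw,
    ← ENNReal.ofReal_mul hκ, ← ENNReal.ofReal_mul (by positivity)]

theorem exp_neg_one_sixteenth_le : Real.exp (-(1 / 16)) ≤ 16 / 17 := by
  rw [Real.exp_neg]
  have : (17 / 16 : ℝ) ≤ Real.exp (1 / 16) := by
    have := Real.add_one_le_exp (1 / 16 : ℝ); linarith
  calc (Real.exp (1 / 16))⁻¹ ≤ (17 / 16 : ℝ)⁻¹ := inv_anti₀ (by norm_num) this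
    _ = 16 / 17 := by norm_num

theorem exp_one_eighth_le : Real.exp (1 / 8) ≤ 8 / 7 := by
  have := Real.exp_bound_div_one_sub_of_interval' (x := 1 / 8) (by norm_num) (by norm_num)
  norm_num at this ⊢
  linarith

theorem exp_nine_eighths_le : Real.exp (9 / 8) ≤ 4 := by
  have h2 : Real.exp (9 / 16) ≤ 1.94 := by
    have := Real.exp_bound_div_one_sub_of_interval' (x := 9 / 32) (by norm_num) (by norm_num)
    rw [show (9 / 16 : ℝ) = 9 / 32 + 9 / 32 by norm_num, Real.exp_add]
    have h3 := Real.exp_pos (9 / 32 : ℝ)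
    norm_num at this
    nlinarith
  rw [show (9 / 8 : ℝ) = 9 / 16 + 9 / 16 by norm_num, Real.exp_add]
  have h3 := Real.exp_pos (9 / 16 : ℝ)
  nlinarith

/-- Used with `x = ε ^ 2`, `u = 1 - w`, `r = 1 - q * w` and `y = ρ ^ 2`: the ratio `y * u / r`
belongs to one more zero in both segments when ones of the first are penalised by `q`. -/
theorem sq_mul_le_of_le_add {x u r y : ℝ} (hx : 0 ≤ x) (hx1 : x ≤ 1 / 1000000000)
    (hu : 0 ≤ u) (hu1 : u ≤ 1) (hr : u + 1900 * x ≤ r) (hy : y ≤ 1 + 0.55 * x) :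
    y * u ≤ (1 - 1890 * x) * r := by
  have h1 : y * u ≤ (1 + 0.55 * x) * u := mul_le_mul_of_nonneg_right hy hu
  have h2 : (1 - 1890 * x) * (u + 1900 * x) ≤ (1 - 1890 * x) * r :=
    mul_le_mul_of_nonneg_left hr (by linarith)
  have h3 : x * u ≤ x := mul_le_of_le_one_right hx hu1
  have h4 : x * x ≤ x * (1 / 1000000000) := mul_le_mul_of_nonneg_left hx1 hx
  linarith

/-- Here `1 - u ^ 2` is the normalised weight of a cell containing a one, about `2 * ε`; its square
is lost because both cells of a pair cannot contain ones. -/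
theorem sq_mul_le_one_sub {x u y ε : ℝ} (hε : 0 < ε) (hx : x = ε ^ 2) (hx1 : x ≤ 1 / 1000000000)
    (hu : 0.9999 ≤ u) (hu1 : u ≤ 1 - ε) (hy0 : 0 ≤ y) (hy : y ≤ 1 + 0.55 * x) :
    y ^ 2 * (1 - (1 - u ^ 2) ^ 2) ≤ 1 - 2.8 * x := by
  have hx0 : 0 ≤ x := hx ▸ sq_nonneg ε
  have h3 : 1.99 * ε ≤ 1 - u ^ 2 := by
    have h : 1 - u ^ 2 = (1 - u) * (1 + u) := by ring
    rw [h]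
    calc 1.99 * ε ≤ ε * (1 + u) := by rw [mul_comm]; gcongr; linarith
      _ ≤ _ := by gcongr; linarith
  have h4 : 3.95 * x ≤ (1 - u ^ 2) ^ 2 := by
    calc 3.95 * x ≤ (1.99 * ε) ^ 2 := by rw [hx]; nlinarith
      _ ≤ _ := by gcongr
  have h5 : y ^ 2 ≤ 1 + 1.11 * x := by
    calc y ^ 2 ≤ (1 + 0.55 * x) ^ 2 := by gcongr
      _ ≤ _ := by nlinarith
  calc _ ≤ y ^ 2 * (1 - 3.95 * x) := by gcongr
    _ ≤ (1 + 1.11 * x) * (1 - 3.95 * x) := by gcongr; linarith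
    _ ≤ _ := by nlinarith

/-- The step weight with strictly more weight per letter than the probability distribution,
for alignments in which segments with equally many zeros have no close pairs of ones. -/
theorem stepWeight_noClosePairs_lt_one {ε : ℝ} (h0 : 0 < ε) (h1 : ε ≤ 1 / 1000000000) :
    ENNReal.ofReal (Real.exp (1 / 8)) * ENNReal.ofReal (Real.exp (ε ^ 2 / 4) * ε) ^ 2 *
      ∑' s : SegPair,
        listWeight (ENNReal.ofReal (Real.exp (ε ^ 2 / 4) * (1 - ε)))
          (ENNReal.ofReal (Real.exp (ε ^ 2 / 4) * ε)) s.1 *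
        listWeight (ENNReal.ofReal (Real.exp (ε ^ 2 / 4) * (1 - ε)))
          (ENNReal.ofReal (Real.exp (ε ^ 2 / 4) * ε)) s.2 *
        segWeight (fun s => NoClosePairs s.1 s.2) (ENNReal.ofReal (Real.exp (-(1 / 16))))
          (ENNReal.ofReal (Real.exp (-(2000 * ε)))) s < 1 := by
  have ht1 := exp_neg_one_sixteenth_le
  have ht0 := Real.exp_pos (-(1 / 16))
  have hk := exp_one_eighth_le
  have hk0 := Real.exp_pos (1 / 8)
  have he2 : ε ^ 2 ≤ 1 / 1000000000 * ε := by
    rw [sq]; exact mul_le_mul_of_nonneg_right h1 h0.le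
  have hε2 : 0 < ε ^ 2 := by positivity
  have hθ1 : 1 ≤ Real.exp (ε ^ 2 / 4) := Real.one_le_exp (by positivity)
  have hθ2 : Real.exp (ε ^ 2 / 4) ≤ 1 + 0.26 * ε ^ 2 := by
    have := Real.abs_exp_sub_one_sub_id_le (x := ε ^ 2 / 4) (by
      rw [abs_of_nonneg (by positivity)]; linarith)
    have := (abs_le.1 this).2
    nlinarith
  have hq0 := Real.exp_pos (-(2000 * ε))
  have hq1 : Real.exp (-(2000 * ε)) ≤ 1 - 1900 * ε := by
    have := Real.abs_exp_sub_one_sub_id_le (x := -(2000 * ε)) (by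
      rw [abs_neg, abs_of_nonneg (by positivity)]; linarith)
    have := (abs_le.1 this).2
    nlinarith
  generalize Real.exp (ε ^ 2 / 4) = θ at *
  generalize Real.exp (-(1 / 16)) = t at *
  generalize Real.exp (-(2000 * ε)) = q at *
  generalize Real.exp (1 / 8) = κ at *
  have hw0 : ε ≤ θ * ε := le_mul_of_one_le_left h0.le hθ1
  have hw1 : θ * ε ≤ 1.0001 * ε := mul_le_mul_of_nonneg_right (by linarith) h0.le
  have hv0 : 0 ≤ θ * (1 - ε) := mul_nonneg (by linarith) (by linarith)
  have hvw : θ * (1 - ε) + θ * ε = θ := by ring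
  generalize θ * ε = w at *
  generalize θ * (1 - ε) = v at *
  have hwu : w < 1 := by linarith
  have hwpos : 0 ≤ w := by linarith
  have hqw : q * w ≤ w - 1900 * ε ^ 2 := by
    calc q * w ≤ (1 - 1900 * ε) * w := mul_le_mul_of_nonneg_right hq1 hwpos
      _ = w - 1900 * (ε * w) := by ring
      _ ≤ w - 1900 * (ε * ε) := by gcongr
      _ = _ := by ring
  have hqw1 : q * w < 1 := by linarith
  obtain ⟨u, hu⟩ : ∃ u, u = 1 - w := ⟨_, rfl⟩
  obtain ⟨r, hr⟩ : ∃ r, r = 1 - q * w := ⟨_, rfl⟩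
  have hu0 : 0.9999 ≤ u := by linarith
  have hu1 : u ≤ 1 := by linarith
  have hupos : 0 < u := by linarith
  -- The weight of a zero together with the gap before it; it is exactly `1` for the unscaled
  -- probabilities.
  obtain ⟨ρ, hρ⟩ : ∃ ρ, ρ = v * u⁻¹ := ⟨_, rfl⟩
  have hρ0 : 0 ≤ ρ := by rw [hρ]; positivity
  have hρ1 : ρ ≤ 1 + 0.27 * ε ^ 2 := by
    rw [hρ, ← div_eq_mul_inv, div_le_iff₀ hupos]
    nlinarith
  have hr0 : u + 1900 * ε ^ 2 ≤ r := by linarith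
  have hrpos : 0 < r := by linarith
  have hW : u⁻¹ ≤ 1.0002 := by
    rw [inv_le_comm₀ hupos (by norm_num)]; refine le_trans ?_ hu0; norm_num
  have hW0 : 0 < u⁻¹ := by positivity
  have hWr : r⁻¹ ≤ 1.0002 := (inv_anti₀ hupos (by linarith)).trans hW
  have hWr0 : 0 < r⁻¹ := by positivity
  have hρ2 : ρ ^ 2 ≤ 1 + 0.55 * ε ^ 2 := by
    calc ρ ^ 2 ≤ (1 + 0.27 * ε ^ 2) ^ 2 := by gcongr
      _ ≤ _ := by nlinarith
  have hg1 : (v * r⁻¹) * (v * u⁻¹) ≤ 1 - 1890 * ε ^ 2 := by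
    have h2 : (v * r⁻¹) * (v * u⁻¹) = ρ ^ 2 * u / r := by
      rw [hρ]; field_simp
    rw [h2, div_le_iff₀ hrpos]
    exact sq_mul_le_of_le_add hε2.le (by linarith) hupos.le hu1 hr0 hρ2
  have htρ : t * ρ ≤ 0.9412 := by
    calc t * ρ ≤ 16 / 17 * (1 + 0.27 * ε ^ 2) := by gcongr
      _ ≤ _ := by linarith
  have htρ0 : 0 ≤ t * ρ := by positivity
  have hA1 : realCellWeight v w ≤ 1 - 2.8 * ε ^ 2 := by
    have h2 : realCellWeight v w = (ρ ^ 2) ^ 2 * (1 - (1 - u ^ 2) ^ 2) := by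
      rw [realCellWeight, hρ, ← hu, show w = 1 - u by linarith]; field_simp; ring
    rw [h2]
    exact sq_mul_le_one_sub h0 rfl (by linarith) hu0 (by linarith) (sq_nonneg ρ) hρ2
  have hA0 : 0 ≤ realCellWeight v w := by
    rw [realCellWeight, ← hu]; positivity
  refine lt_of_le_of_lt (stepWeight_noClosePairs_le hv0 hwpos hwu ht0.le hq0.le hk0.le hqw1
    (by rw [← hr, ← hu]; linarith) (by rw [← hu, ← hρ]; linarith) hA0 (by linarith)) ?_
  rw [ENNReal.ofReal_lt_one, unequalWeight, ← hu, ← hr]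
  generalize realCellWeight v w = A at *
  have hW2 : u⁻¹ ^ 2 ≤ 1.0005 := by
    calc u⁻¹ ^ 2 ≤ 1.0002 ^ 2 := by gcongr
      _ ≤ _ := by norm_num
  have hF1 : (u⁻¹ ^ 2 + v ^ 2 * u⁻¹ ^ 4) * (1 - A)⁻¹ ≤ 2.01 * (2.8 * ε ^ 2)⁻¹ := by
    have h2 : v ^ 2 * u⁻¹ ^ 4 = ρ ^ 2 * u⁻¹ ^ 2 := by rw [hρ]; ring
    have h4 : ρ ^ 2 * u⁻¹ ^ 2 ≤ 1.001 * 1.0005 := by gcongr; linarith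
    refine mul_le_mul ?_ (inv_anti₀ (by positivity) (by linarith)) (by
      rw [inv_nonneg]; linarith) (by norm_num)
    rw [h2]
    linarith
  have hF2 : r⁻¹ * u⁻¹ * (1 - v * r⁻¹ * (v * u⁻¹))⁻¹ * (t * (v * u⁻¹) * (1 - t * (v * u⁻¹))⁻¹) ≤
      (1.0002 * 1.0002) * (1890 * ε ^ 2)⁻¹ * 16.01 := by
    generalize v * r⁻¹ * (v * u⁻¹) = g at *
    rw [← hρ]
    have h3 : t * ρ * (1 - t * ρ)⁻¹ ≤ 16.01 := by
      rw [← div_eq_mul_inv, div_le_iff₀ (by linarith)]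
      linarith
    have h4 : 0 ≤ t * ρ * (1 - t * ρ)⁻¹ := mul_nonneg htρ0 (by rw [inv_nonneg]; linarith)
    refine mul_le_mul (mul_le_mul (by gcongr) (inv_anti₀ (by positivity) (by linarith)) (by
      rw [inv_nonneg]; linarith) (by norm_num)) h3 h4 (by positivity)
  have hF := add_le_add hF1 (mul_le_mul_of_nonneg_left hF2 zero_le_two)
  have hw2 : w ^ 2 ≤ (1.0001 * ε) ^ 2 := by gcongr
  -- The powers of `ε` cancel. Equal zero counts contribute about `0.82`, unequal ones about `0.02`;
  -- the large penalty `2000 * ε` serves to make the latter small.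
  calc _ ≤ 8 / 7 * (1.0001 * ε) ^ 2 * (2.01 * (2.8 * ε ^ 2)⁻¹ +
        2 * ((1.0002 * 1.0002) * (1890 * ε ^ 2)⁻¹ * 16.01)) := by
        refine (mul_le_mul_of_nonneg_left hF (by positivity)).trans ?_
        gcongr
    _ = 8 / 7 * 1.0001 ^ 2 * (2.01 / 2.8 + 2 * (1.0002 * 1.0002 / 1890 * 16.01)) := by
        field_simp
    _ < 1 := by norm_num

/-- The step weight with strictly less weight per letter than the probability distribution,
for arbitrary alignments. -/
theorem stepWeight_true_lt_one {ε : ℝ} (h0 : 0 < ε) (h1 : ε ≤ 1 / 1000000000) :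
    ENNReal.ofReal (Real.exp (9 / 8)) * ENNReal.ofReal (Real.exp (-(200 * ε ^ 2)) * ε) ^ 2 *
      ∑' s : SegPair,
        listWeight (ENNReal.ofReal (Real.exp (-(200 * ε ^ 2)) * (1 - ε)))
          (ENNReal.ofReal (Real.exp (-(200 * ε ^ 2)) * ε)) s.1 *
        listWeight (ENNReal.ofReal (Real.exp (-(200 * ε ^ 2)) * (1 - ε)))
          (ENNReal.ofReal (Real.exp (-(200 * ε ^ 2)) * ε)) s.2 *
        segWeight (fun _ => True) (ENNReal.ofReal (Real.exp (-(1 / 16))))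
          (ENNReal.ofReal (Real.exp (-0))) s < 1 := by
  rw [neg_zero, Real.exp_zero]
  have ht1 := exp_neg_one_sixteenth_le
  have ht0 := Real.exp_pos (-(1 / 16))
  have hk := exp_nine_eighths_le
  have hk0 := Real.exp_pos (9 / 8)
  have he2 : ε ^ 2 ≤ 1 / 1000000000 * ε := by
    rw [sq]; exact mul_le_mul_of_nonneg_right h1 h0.le
  have hε2 : 0 < ε ^ 2 := by positivity
  have hθ0 := Real.exp_pos (-(200 * ε ^ 2))
  have hθ2 : Real.exp (-(200 * ε ^ 2)) ≤ 1 - 150 * ε ^ 2 := by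
    have := Real.abs_exp_sub_one_sub_id_le (x := -(200 * ε ^ 2)) (by
      rw [abs_neg, abs_of_nonneg (by positivity)]; linarith)
    have := (abs_le.1 this).2
    nlinarith
  generalize Real.exp (-(200 * ε ^ 2)) = θ at *
  generalize Real.exp (-(1 / 16)) = t at *
  generalize Real.exp (9 / 8) = κ at *
  have hwpos : 0 ≤ θ * ε := by positivity
  have hw1 : θ * ε ≤ ε := mul_le_of_le_one_left h0.le (by linarith)
  have hv0 : 0 ≤ θ * (1 - ε) := mul_nonneg (by linarith) (by linarith)
  have hvw : θ * (1 - ε) + θ * ε = θ := by ring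
  generalize θ * ε = w at *
  generalize θ * (1 - ε) = v at *
  have hwu : w < 1 := by linarith
  obtain ⟨u, hu⟩ : ∃ u, u = 1 - w := ⟨_, rfl⟩
  have hu0 : 0.9999 ≤ u := by linarith
  have hu1 : u ≤ 1 := by linarith
  have hupos : 0 < u := by linarith
  have hW : u⁻¹ ≤ 1.0002 := by
    rw [inv_le_comm₀ hupos (by norm_num)]; refine le_trans ?_ hu0; norm_num
  have hW0 : 0 < u⁻¹ := by positivity
  obtain ⟨ρ, hρ⟩ : ∃ ρ, ρ = v * u⁻¹ := ⟨_, rfl⟩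
  have hρ0 : 0 ≤ ρ := by rw [hρ]; positivity
  have hρ1 : ρ ≤ 1 - 150 * ε ^ 2 := by
    rw [hρ, ← div_eq_mul_inv, div_le_iff₀ hupos]
    nlinarith
  have hρ2 : ρ ^ 2 ≤ 1 - 150 * ε ^ 2 := by
    rw [sq]; exact (mul_le_of_le_one_left hρ0 (by linarith)).trans hρ1
  have htρ : t * ρ ≤ 16 / 17 := (mul_le_of_le_one_right ht0.le (by linarith)).trans ht1
  have htρ0 : 0 ≤ t * ρ := by positivity
  refine lt_of_le_of_lt (stepWeight_true_le hv0 hwpos hwu ht0.le hk0.le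
    (by rw [← hu, ← hρ]; linarith) (by rw [← hu, ← hρ]; linarith)) ?_
  rw [ENNReal.ofReal_lt_one, unequalWeight, one_mul, ← hu, ← hρ, ← sq, ← sq]
  have hG : (1 - ρ ^ 2)⁻¹ ≤ (150 * ε ^ 2)⁻¹ := inv_anti₀ (by positivity) (by linarith)
  have hG0 : 0 ≤ (1 - ρ ^ 2)⁻¹ := by rw [inv_nonneg]; linarith
  have hT : t * ρ * (1 - t * ρ)⁻¹ ≤ 16 := by
    rw [← div_eq_mul_inv, div_le_iff₀ (by linarith)]
    linarith
  have hT1 : 0 ≤ (1 - t * ρ)⁻¹ := by rw [inv_nonneg]; linarith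
  -- Again `ε` cancels, leaving about `4 * 33 / 150`; convergence comes from shrinking the letter
  -- weights alone.
  calc _ ≤ 4 * ε ^ 2 * (1.0002 ^ 2 * (150 * ε ^ 2)⁻¹ +
        2 * (1.0002 ^ 2 * (150 * ε ^ 2)⁻¹ * 16)) := by
        gcongr
    _ = 4 * (1.0002 ^ 2 / 150 + 2 * (1.0002 ^ 2 / 150 * 16)) := by
        field_simp
    _ < 1 := by norm_num

/-! ### Exponential probability bounds -/

/-- Probability of a pair of texts. -/
def pairMass {n : ℕ} (ε : ℝ) (p : TextPair n) : ℝ≥0∞ :=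
  listWeight (ENNReal.ofReal (1 - ε)) (ENNReal.ofReal ε) (textList p.1) *
    listWeight (ENNReal.ofReal (1 - ε)) (ENNReal.ofReal ε) (textList p.2)

theorem listWeight_smul {θ a b : ℝ} (hθ : 0 ≤ θ) (x : List Bool) :
    listWeight (ENNReal.ofReal (θ * a)) (ENNReal.ofReal (θ * b)) x =
      ENNReal.ofReal (θ ^ x.length) * listWeight (ENNReal.ofReal a) (ENNReal.ofReal b) x := by
  rw [listWeight, listWeight, ENNReal.ofReal_mul hθ, ENNReal.ofReal_mul hθ,
    ENNReal.ofReal_pow hθ, ← List.count_false_add_count_true x]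
  ring

theorem ofReal_exp_le_prod_segWeight {V : SegPair → Prop} {c τ ζ : ℝ} (l : List SegPair)
    (hV : ∀ s ∈ l, s.1.count false = s.2.count false → V s) :
    ENNReal.ofReal (Real.exp (c * l.length - τ * (l.map zeroGap).sum -
        ζ * (l.map fun s => scarceOnes s + scarceOnes s.swap).sum)) ≤
      (l.map fun s => ENNReal.ofReal (Real.exp c) *
        segWeight V (ENNReal.ofReal (Real.exp (-τ))) (ENNReal.ofReal (Real.exp (-ζ))) s).prod := by
  induction l with
  | nil => simp
  | cons s t ih =>
    have h1 : ENNReal.ofReal (Real.exp (c - τ * zeroGap s - ζ * (scarceOnes s + scarceOnes s.swap :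
        ℕ))) ≤ ENNReal.ofReal (Real.exp c) * segWeight V (ENNReal.ofReal (Real.exp (-τ)))
          (ENNReal.ofReal (Real.exp (-ζ))) s := by
      unfold segWeight
      split_ifs with h hVs
      · have h2 : zeroGap s = 0 := by simp [zeroGap, h]
        have h3 : scarceOnes s + scarceOnes s.swap = 0 := by simp [scarceOnes, h]
        simp [h2, h3]
      · exact absurd (hV s (by simp) h) hVs
      · rw [← ENNReal.ofReal_pow (Real.exp_nonneg _), ← ENNReal.ofReal_pow (Real.exp_nonneg _),
          ← ENNReal.ofReal_mul (by positivity), ← ENNReal.ofReal_mul (by positivity),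
          ← Real.exp_nat_mul, ← Real.exp_nat_mul, ← Real.exp_add, ← Real.exp_add]
        exact le_of_eq (by congr 2; ring)
    have h2 := ih fun s' hs' => hV s' (by simp [hs'])
    simp only [List.map_cons, List.prod_cons, List.length_cons, List.sum_cons]
    refine le_trans (le_of_eq ?_) (mul_le_mul' h1 h2)
    rw [← ENNReal.ofReal_mul (Real.exp_nonneg _), ← Real.exp_add]
    congr 2
    push_cast
    ring

/-- Exponential bound obtained from the first moment of the number of alignments. -/
theorem exists_sum_pairMass_le {V : SegPair → Prop} {ε b c τ ζ : ℝ} (h0 : 0 < ε)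
    (hstep : ENNReal.ofReal (Real.exp c) * ENNReal.ofReal (Real.exp b * ε) ^ 2 *
      ∑' s : SegPair, listWeight (ENNReal.ofReal (Real.exp b * (1 - ε)))
        (ENNReal.ofReal (Real.exp b * ε)) s.1 *
        listWeight (ENNReal.ofReal (Real.exp b * (1 - ε))) (ENNReal.ofReal (Real.exp b * ε)) s.2 *
        segWeight V (ENNReal.ofReal (Real.exp (-τ))) (ENNReal.ofReal (Real.exp (-ζ))) s < 1) :
    ∃ C : ℝ, 0 ≤ C ∧ ∀ (n : ℕ) (S : Finset (TextPair n)) (E : ℝ),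
      (∀ p ∈ S, ∃ l, IsAlignment (textList p.1) (textList p.2) l ∧
        (∀ s ∈ l, s.1.count false = s.2.count false → V s) ∧
        E ≤ c * l.length - τ * (l.map zeroGap).sum -
          ζ * (l.map fun s => scarceOnes s + scarceOnes s.swap).sum) →
      ∑ p ∈ S, pairMass ε p ≤ ENNReal.ofReal (C * Real.exp (-(2 * b * n) - E)) := by
  set σ := ENNReal.ofReal (Real.exp c) * ENNReal.ofReal (Real.exp b * ε) ^ 2 *
      ∑' s : SegPair, listWeight (ENNReal.ofReal (Real.exp b * (1 - ε)))
        (ENNReal.ofReal (Real.exp b * ε)) s.1 *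
        listWeight (ENNReal.ofReal (Real.exp b * (1 - ε))) (ENNReal.ofReal (Real.exp b * ε)) s.2 *
        segWeight V (ENNReal.ofReal (Real.exp (-τ))) (ENNReal.ofReal (Real.exp (-ζ))) s with hσ
  have hfin : (1 - σ)⁻¹ ≠ ∞ := ENNReal.inv_ne_top.2 (tsub_pos_of_lt hstep).ne'
  have hw : 0 < (Real.exp b * ε) ^ 2 := by positivity
  -- The denominator is the weight of the two artificial leading ones.
  refine ⟨((1 - σ)⁻¹).toReal / (Real.exp b * ε) ^ 2, by positivity, fun n S E h => ?_⟩
  have key := sum_listWeight_le S (ENNReal.ofReal (Real.exp b * (1 - ε)))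
    (ENNReal.ofReal (Real.exp b * ε)) (ENNReal.ofReal (Real.exp c)) (ENNReal.ofReal (Real.exp E))
    (segWeight V (ENNReal.ofReal (Real.exp (-τ))) (ENNReal.ofReal (Real.exp (-ζ)))) (by
      intro p hp
      obtain ⟨l, hl, hV, hE⟩ := h p hp
      exact ⟨l, hl, (ENNReal.ofReal_le_ofReal (Real.exp_le_exp.2 hE)).trans
        (ofReal_exp_le_prod_segWeight l hV)⟩)
  rw [← hσ] at key
  -- Each of the `2 * n` letters carries a factor `exp b` beyond its probability.
  have hsum : ∑ p ∈ S, listWeight (ENNReal.ofReal (Real.exp b * (1 - ε)))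
        (ENNReal.ofReal (Real.exp b * ε)) (textList p.1) *
        listWeight (ENNReal.ofReal (Real.exp b * (1 - ε))) (ENNReal.ofReal (Real.exp b * ε))
          (textList p.2) = ENNReal.ofReal (Real.exp (2 * b * n)) * ∑ p ∈ S, pairMass ε p := by
    rw [Finset.mul_sum]
    refine Finset.sum_congr rfl fun p _ => ?_
    rw [listWeight_smul (Real.exp_nonneg _), listWeight_smul (Real.exp_nonneg _),
      length_textList, length_textList, pairMass,
      show 2 * b * n = n * b + n * b by ring, Real.exp_add, Real.exp_nat_mul,
      ENNReal.ofReal_mul (by positivity)]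
    ring
  rw [hsum, ← ENNReal.ofReal_pow (by positivity), ← ENNReal.ofReal_mul (by positivity), ← mul_assoc,
    ← ENNReal.ofReal_mul (by positivity), ← ENNReal.ofReal_toReal hfin, mul_comm,
    ← ENNReal.le_div_iff_mul_le (by left; simp; positivity) (by left; simp),
    ← ENNReal.ofReal_div_of_pos (by positivity)] at key
  refine key.trans_eq ?_
  congr 1
  rw [sub_eq_add_neg, ← neg_add, Real.exp_neg, Real.exp_add]
  field_simp

theorem listWeight_textList {n : ℕ} (a b : ℝ≥0∞) (x : Text n) :
    listWeight a b (textList x) = ∏ i, (if x i = 1 then b else a) := by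
  induction n with
  | zero => simp [textList, listWeight]
  | succ n ih =>
    rw [textList_succ, Fin.prod_univ_succ]
    rcases eq_or_ne (x 0) 1 with h | h
    · rw [if_pos h, decide_eq_true h, listWeight_true_cons, ih]; rfl
    · rw [if_neg h, decide_eq_false h, listWeight_false_cons, ih]; rfl

theorem sum_listWeight_textList (n : ℕ) (a b : ℝ≥0∞) :
    ∑ x : Text n, listWeight a b (textList x) = (a + b) ^ n := by
  simp only [listWeight_textList]
  have := Fintype.sum_pow (fun c : Fin 2 => if c = 1 then b else a) n
  rw [← this]
  simp [Fin.sum_univ_two]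

/-- Chernoff bound for the numbers of ones of the two texts. -/
theorem sum_pairMass_le_of_count {n : ℕ} {ε s₁ s₂ E : ℝ} (h0 : 0 ≤ ε) (h1 : ε ≤ 1)
    (S : Finset (TextPair n))
    (h : ∀ p ∈ S, E ≤ s₁ * (textList p.1).count true + s₂ * (textList p.2).count true) :
    ∑ p ∈ S, pairMass ε p ≤
      ENNReal.ofReal (Real.exp (ε * n * (Real.exp s₁ + Real.exp s₂ - 2) - E)) := by
  have hε : 0 ≤ 1 - ε := by linarith
  have hb : ∀ s : ℝ, ENNReal.ofReal (1 - ε) + ENNReal.ofReal (ε * Real.exp s) ≤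
      ENNReal.ofReal (Real.exp (ε * (Real.exp s - 1))) := fun s => by
    rw [← ENNReal.ofReal_add hε (by positivity)]
    refine ENNReal.ofReal_le_ofReal ?_
    have := Real.add_one_le_exp (ε * (Real.exp s - 1))
    linarith
  have hw : ∀ (s : ℝ) (x : List Bool), listWeight (ENNReal.ofReal (1 - ε))
      (ENNReal.ofReal (ε * Real.exp s)) x = ENNReal.ofReal (Real.exp (s * x.count true)) *
        listWeight (ENNReal.ofReal (1 - ε)) (ENNReal.ofReal ε) x := fun s x => by
    rw [listWeight, listWeight, ENNReal.ofReal_mul h0, mul_pow, mul_comm s, Real.exp_nat_mul,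
      ENNReal.ofReal_pow (Real.exp_nonneg s)]
    ring
  calc ∑ p ∈ S, pairMass ε p
      ≤ ∑ p ∈ S, ENNReal.ofReal (Real.exp (-E)) *
        (listWeight (ENNReal.ofReal (1 - ε)) (ENNReal.ofReal (ε * Real.exp s₁)) (textList p.1) *
        listWeight (ENNReal.ofReal (1 - ε)) (ENNReal.ofReal (ε * Real.exp s₂)) (textList p.2)) := by
        refine Finset.sum_le_sum fun p hp => ?_
        rw [hw, hw]
        have : 1 ≤ ENNReal.ofReal (Real.exp (-E)) *
            (ENNReal.ofReal (Real.exp (s₁ * (textList p.1).count true)) *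
            ENNReal.ofReal (Real.exp (s₂ * (textList p.2).count true))) := by
          rw [← ENNReal.ofReal_mul (by positivity), ← ENNReal.ofReal_mul (by positivity),
            ← Real.exp_add, ← Real.exp_add, ENNReal.one_le_ofReal]
          exact Real.one_le_exp (by linarith [h p hp])
        calc pairMass ε p = 1 * pairMass ε p := (one_mul _).symm
          _ ≤ _ := mul_le_mul_left this _
          _ = _ := by rw [pairMass]; ring
    _ ≤ ENNReal.ofReal (Real.exp (-E)) * ∑ p : TextPair n,
        (listWeight (ENNReal.ofReal (1 - ε)) (ENNReal.ofReal (ε * Real.exp s₁)) (textList p.1) *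
        listWeight (ENNReal.ofReal (1 - ε)) (ENNReal.ofReal (ε * Real.exp s₂)) (textList p.2)) := by
        rw [← Finset.mul_sum]
        exact mul_le_mul_right (Finset.sum_le_sum_of_subset (Finset.subset_univ S)) _
    _ = ENNReal.ofReal (Real.exp (-E)) *
        ((ENNReal.ofReal (1 - ε) + ENNReal.ofReal (ε * Real.exp s₁)) ^ n *
        (ENNReal.ofReal (1 - ε) + ENNReal.ofReal (ε * Real.exp s₂)) ^ n) := by
        rw [Fintype.sum_prod_type, ← sum_listWeight_textList n, ← sum_listWeight_textList n,
          Finset.sum_mul_sum]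
    _ ≤ ENNReal.ofReal (Real.exp (-E)) *
        (ENNReal.ofReal (Real.exp (ε * (Real.exp s₁ - 1))) ^ n *
        ENNReal.ofReal (Real.exp (ε * (Real.exp s₂ - 1))) ^ n) := by
        gcongr <;> exact hb _
    _ = _ := by
        rw [← ENNReal.ofReal_pow (by positivity), ← ENNReal.ofReal_pow (by positivity),
          ← ENNReal.ofReal_mul (by positivity), ← ENNReal.ofReal_mul (by positivity),
          ← Real.exp_nat_mul, ← Real.exp_nat_mul, ← Real.exp_add, ← Real.exp_add]
        congr 2
        ring

/-! ### The laws in terms of weights and counts -/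

instance isProbabilityMeasure_textLaw (n : ℕ) (ε : unitInterval) :
    IsProbabilityMeasure (textLaw n ε) := by
  unfold textLaw; infer_instance

instance isMarkovKernel_flipKernel (n : ℕ) : IsMarkovKernel (flipKernel n) :=
  ⟨fun p => by
    change IsProbabilityMeasure (flipLaw p).toMeasure
    infer_instance⟩

instance isProbabilityMeasure_jointLaw (n : ℕ) (ε : unitInterval) :
    IsProbabilityMeasure (jointLaw n ε) := by
  unfold jointLaw; infer_instance

theorem textLaw_singleton {n : ℕ} (ε : unitInterval) (x : Text n) :
    textLaw n ε {x} =
      listWeight (ENNReal.ofReal (1 - ε)) (ENNReal.ofReal ε) (textList x) := by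
  rw [textLaw, Measure.pi_singleton, listWeight_textList]
  refine Finset.prod_congr rfl fun i _ => ?_
  rw [bernoulliMeasure_apply ε (MeasurableSet.singleton _)]
  generalize x i = c
  have h1 : ((unitInterval.toNNReal ε : NNReal) : ℝ≥0∞) = ENNReal.ofReal ε := by
    rw [ENNReal.ofReal]; congr 1; ext; simp [ε.2.1]
  have h2 : ((unitInterval.toNNReal (unitInterval.symm ε) : NNReal) : ℝ≥0∞) =
      ENNReal.ofReal (1 - ε) := by
    rw [ENNReal.ofReal]; congr 1; ext; simp [ε.2.2]
  fin_cases c <;> simp [h1, h2]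

theorem prod_textLaw_singleton {n : ℕ} (ε : unitInterval) (p : TextPair n) :
    ((textLaw n ε).prod (textLaw n ε)) {p} = pairMass ε p := by
  rw [← Prod.mk.eta (p := p), ← Set.singleton_prod_singleton, Measure.prod_prod,
    textLaw_singleton, textLaw_singleton, pairMass]

theorem jointLaw_originalIn {n : ℕ} (ε : unitInterval) (S : Finset (TextPair n)) :
    jointLaw n ε (originalIn S) = ∑ p ∈ S, pairMass ε p := by
  have h : originalIn (S : Set (TextPair n)) = Prod.fst ⁻¹' (S : Set (TextPair n)) := rfl
  rw [h, ← Measure.fst_apply (Finset.measurableSet S), jointLaw, Measure.fst_compProd,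
    ← sum_measure_singleton]
  exact Finset.sum_congr rfl fun p _ => prod_textLaw_singleton ε p

theorem pairMass_pos {n : ℕ} {ε : ℝ} (h0 : 0 < ε) (h1 : ε < 1) (p : TextPair n) :
    0 < pairMass ε p := by
  have h2 : ENNReal.ofReal (1 - ε) ≠ 0 := by simp [h1]
  have h3 : ENNReal.ofReal ε ≠ 0 := by simp [h0]
  unfold pairMass listWeight
  exact pos_iff_ne_zero.2 (mul_ne_zero (mul_ne_zero (pow_ne_zero _ h2) (pow_ne_zero _ h3))
    (mul_ne_zero (pow_ne_zero _ h2) (pow_ne_zero _ h3)))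

theorem flipKernel_apply {n : ℕ} (p : TextPair n) (hp : (onePositions p).Nonempty) (d : ℤ) :
    flipKernel n p {q | (lcs q : ℤ) - (lcs p : ℤ) = d} =
      (changingOnes p d).card / (onePositions p).card := by
  classical
  change (flipLaw p).toMeasure _ = _
  rw [flipLaw, dif_pos hp, PMF.toMeasure_apply_eq_toOuterMeasure_apply _ MeasurableSet.of_discrete,
    PMF.toOuterMeasure_map_apply, PMF.toOuterMeasure_uniformOfFinset_apply]
  congr 3
  unfold changingOnes
  ext s
  simp

theorem cond_jointLaw_lcsChange {n : ℕ} {ε : unitInterval} (h0 : 0 < (ε : ℝ)) (h1 : (ε : ℝ) < 1)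
    (p : TextPair n) (hp : (onePositions p).Nonempty) (d : ℤ) :
    (cond (jointLaw n ε) (originalIn {p})).real (lcsChange n d) =
      (changingOnes p d).card / (onePositions p).card := by
  have hpos := (pairMass_pos h0 h1 p).ne'
  have h2 : originalIn {p} ∩ lcsChange n d = {p} ×ˢ {q | (lcs q : ℤ) - (lcs p : ℤ) = d} := by
    ext ⟨a, b⟩
    simp only [originalIn, lcsChange, Set.mem_inter_iff, Set.mem_ofPred_eq, Set.mem_singleton_iff,
      Set.mem_prod]
    constructor
    · rintro ⟨rfl, h⟩; exact ⟨rfl, h⟩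
    · rintro ⟨rfl, h⟩; exact ⟨rfl, h⟩
  have h3 : jointLaw n ε (originalIn {p}) = pairMass ε p := by
    have := jointLaw_originalIn ε {p}
    simpa using this
  have h4 : pairMass (ε : ℝ) p ≠ ∞ := by rw [← h3]; exact measure_ne_top _ _
  rw [measureReal_def, cond_apply MeasurableSet.of_discrete, h2, h3, jointLaw,
    Measure.compProd_apply_prod (MeasurableSet.singleton p) MeasurableSet.of_discrete,
    lintegral_singleton, prod_textLaw_singleton, flipKernel_apply p hp, mul_comm, mul_assoc,
    ENNReal.mul_inv_cancel hpos h4, mul_one, ENNReal.toReal_div, ENNReal.toReal_natCast,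
    ENNReal.toReal_natCast]

/-! ### Good pairs and their probability -/

/-- The pairs of texts for which a fraction of at least `1 / 100000` of the ones increases the
length of the longest common subsequence, while at most half as many ones decrease it. -/
def goodPairs (n : ℕ) : Set (TextPair n) :=
  {p | 0 < (onePositions p).card ∧
    1 / 100000 * ((onePositions p).card : ℝ) ≤ (changingOnes p 1).card ∧
    ((changingOnes p (-1)).card : ℝ) ≤ 1 / 200000 * (onePositions p).card}

/-- The pair `0…0` and `10…0` has a single one, and flipping it makes the strings equal. This yields
positive probability for every positive length, as needed for small `n`. -/
theorem exists_mem_goodPairs (m : ℕ) : ∃ p, p ∈ goodPairs (m + 1) := by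
  set z : Text m := fun _ => 0 with hz
  set x : Text (m + 1) := Fin.cons 0 z with hx
  set y : Text (m + 1) := Fin.cons 1 z with hy
  have hxl : textList x = false :: textList z := textList_succ x
  have hyl : textList y = true :: textList z := textList_succ y
  have hz0 : (textList z).count true = 0 := by
    rw [flipCount_true_textList]; simp [hz]
  have hN : (onePositions (x, y)).card = 1 := by
    rw [card_onePositions]
    simp [hxl, hyl, hz0]
  have hlt : lcs (x, y) = m := by
    rw [lcs_eq_listLcs]
    apply le_antisymm
    · by_contra! h
      obtain ⟨l, h1, h2, h3⟩ := exists_length_eq_listLcs (textList x) (textList y)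
      simp only at h
      have h4 := h1.length_le
      have h5 := h2.length_le
      rw [length_textList] at h4 h5
      have h6 := (h1.eq_of_length (by rw [length_textList]; omega)).symm.trans
        (h2.eq_of_length (by rw [length_textList]; omega))
      rw [hxl, hyl] at h6
      simp at h6
    · have := length_le_listLcs (x := textList x) (y := textList y) (m := textList z)
        (by rw [hxl]; exact List.sublist_cons_self _ _)
        (by rw [hyl]; exact List.sublist_cons_self _ _)
      rwa [length_textList] at this
  have hone : ∀ s ∈ onePositions (x, y), (lcs (putZero (x, y) s) : ℤ) - lcs (x, y) = 1 := by
    intro s hs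
    have hs : symbolAt (x, y) s = 1 := (Finset.mem_filter.1 hs).2
    rcases s with i | i
    · refine Fin.cases (fun hs => ?_) (fun i hs => ?_) i hs <;> simp [symbolAt, hx, hz] at hs
    · have hi : i = 0 := by
        by_contra h
        obtain ⟨j, rfl⟩ := Fin.exists_succ_eq.2 h
        simp [symbolAt, hy, hz] at hs
      subst hi
      have h1 : putZero (x, y) (Sum.inr 0) = (x, x) := by
        simp only [putZero, hx, hy, Fin.update_cons_zero]
      have h2 : lcs (x, x) = m + 1 := by
        rw [lcs_eq_listLcs]
        apply le_antisymm
        · obtain ⟨l, h1, -, h3⟩ := exists_length_eq_listLcs (textList x) (textList x)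
          have := h1.length_le
          rw [length_textList] at this
          exact h3 ▸ this
        · have := length_le_listLcs (List.Sublist.refl (textList x)) (List.Sublist.refl (textList x))
          rwa [length_textList] at this
      rw [h1, h2, hlt]
      push_cast
      ring
  have hp : (changingOnes (x, y) 1).card = 1 := by
    rw [changingOnes, Finset.filter_true_of_mem hone, hN]
  have hm : (changingOnes (x, y) (-1)).card = 0 := by
    rw [Finset.card_eq_zero, changingOnes, Finset.filter_eq_empty_iff]
    intro s hs h
    rw [hone s hs] at h
    norm_num at h
  refine ⟨(x, y), ?_⟩
  simp only [goodPairs, Set.mem_ofPred_eq, hN, hp, hm]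
  norm_num

theorem sum_filter_or_le {α : Type*} (s : Finset α) (P Q : α → Prop) [DecidablePred P]
    [DecidablePred Q] (f : α → ℝ≥0∞) :
    ∑ a ∈ s with P a ∨ Q a, f a ≤ ∑ a ∈ s with P a, f a + ∑ a ∈ s with Q a, f a := by
  rw [Finset.sum_filter, Finset.sum_filter, Finset.sum_filter, ← Finset.sum_add_distrib]
  refine Finset.sum_le_sum fun a _ => ?_
  by_cases h1 : P a <;> by_cases h2 : Q a <;> simp [h1, h2]

/-- Removes the constant `C`: for large `n` half of the rate absorbs it, and for the finitely many
other `n` the bound `f n < 1` allows some positive rate. -/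
theorem exists_rate {f : ℕ → ℝ} {C c : ℝ} (hc : 0 < c) (h1 : ∀ n, 1 ≤ n → f n < 1)
    (hf : ∀ n : ℕ, 1 ≤ n → f n ≤ C * Real.exp (-c * n)) :
    ∃ c₁ : ℝ, 0 < c₁ ∧ ∀ n : ℕ, 1 ≤ n → f n ≤ Real.exp (-c₁ * n) := by
  have mono : ∀ {a b : ℝ} (n : ℕ), a ≤ b → Real.exp (-b * n) ≤ Real.exp (-a * n) :=
    fun n h => Real.exp_le_exp.2 (mul_le_mul_of_nonneg_right (neg_le_neg h) n.cast_nonneg)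
  have small : ∀ N : ℕ, ∃ c₁ : ℝ, 0 < c₁ ∧ ∀ n : ℕ, 1 ≤ n → n < N → f n ≤ Real.exp (-c₁ * n) := by
    intro N
    induction N with
    | zero => exact ⟨1, one_pos, fun n _ h => absurd h (Nat.not_lt_zero n)⟩
    | succ N ih =>
      obtain ⟨c₁, hc₁, h⟩ := ih
      rcases Nat.eq_zero_or_pos N with rfl | hN
      · exact ⟨1, one_pos, fun n h1 h2 => by omega⟩
      have hN' : (0 : ℝ) < N := Nat.cast_pos.2 hN
      obtain ⟨b, hb0, hb⟩ : ∃ b : ℝ, 0 < b ∧ f N ≤ Real.exp (-b * N) := by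
        rcases le_or_gt (f N) 0 with h0 | h0
        · exact ⟨1, one_pos, h0.trans (Real.exp_nonneg _)⟩
        · refine ⟨-Real.log (f N) / N, div_pos (neg_pos.2 (Real.log_neg h0 (h1 N hN))) hN', ?_⟩
          rw [neg_div, neg_neg, div_mul_cancel₀ _ hN'.ne', Real.exp_log h0]
      refine ⟨min b c₁, lt_min hb0 hc₁, fun n hn hlt => ?_⟩
      rcases Nat.lt_succ_iff_lt_or_eq.1 hlt with h2 | rfl
      · exact (h n hn h2).trans (mono n (min_le_right _ _))
      · exact hb.trans (mono n (min_le_left _ _))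
  obtain ⟨N, hN⟩ := exists_nat_gt (C / (c / 2))
  obtain ⟨b, hb0, hb⟩ := small N
  refine ⟨min b (c / 2), lt_min hb0 (by positivity), fun n hn => ?_⟩
  rcases lt_or_ge n N with h | h
  · exact (hb n hn h).trans (mono n (min_le_left _ _))
  · refine ((hf n hn).trans ?_).trans (mono n (min_le_right b (c / 2)))
    have h2 : C ≤ Real.exp (c / 2 * n) := by
      have h3 : C / (c / 2) ≤ n := hN.le.trans (by exact_mod_cast h)
      rw [div_le_iff₀ (by positivity)] at h3
      have := Real.add_one_le_exp (c / 2 * n)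
      linarith
    calc C * Real.exp (-c * n) ≤ Real.exp (c / 2 * n) * Real.exp (-c * n) := by gcongr
      _ = Real.exp (-(c / 2) * n) := by rw [← Real.exp_add]; congr 1; ring

open scoped Classical in
theorem exists_sum_compl_goodPairs_le {ε : ℝ} (h0 : 0 < ε) (h1 : ε ≤ 1 / 1000000000) :
    ∃ C : ℝ, 0 ≤ C ∧ ∀ n : ℕ, 1 ≤ n → ∑ p : TextPair n with p ∉ goodPairs n,
      pairMass ε p ≤ ENNReal.ofReal (C * Real.exp (-(ε ^ 3 / 8) * n)) := by
  obtain ⟨C₁, hC₁, key₁⟩ := exists_sum_pairMass_le h0 (stepWeight_noClosePairs_lt_one h0 h1)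
  obtain ⟨C₂, hC₂, key₂⟩ := exists_sum_pairMass_le h0 (stepWeight_true_lt_one h0 h1)
  refine ⟨1 + (1 + (1 + (1 + (C₁ + C₂)))), by positivity, fun n hn => ?_⟩
  have hn0 : (0 : ℝ) < n := by exact_mod_cast hn
  set x : TextPair n → ℝ := fun p => (textList p.1).count true with hx
  set y : TextPair n → ℝ := fun p => (textList p.2).count true with hy
  have hεn : 0 < ε * n := by positivity
  have hε2n : ε ^ 2 * n ≤ 1 / 1000000000 * (ε * n) := by
    nlinarith [mul_le_mul_of_nonneg_right h1 hεn.le]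
  have hε2n0 : 0 < ε ^ 2 * n := by positivity
  have hε3n : ε ^ 3 * n ≤ 1 / 1000000000 * (ε ^ 2 * n) := by
    nlinarith [mul_le_mul_of_nonneg_right h1 hε2n0.le]
  have hε3n0 : 0 < ε ^ 3 * n := by positivity
  set r := Real.exp (-(ε ^ 3 / 8) * n) with hr
  have e1 : ∑ p : TextPair n with x p + y p < ε * n, pairMass ε p ≤ ENNReal.ofReal (1 * r) := by
    refine (sum_pairMass_le_of_count (s₁ := -1) (s₂ := -1) (E := -(ε * n)) h0.le (by linarith) _
      fun p hp => ?_).trans ?_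
    · have := (Finset.mem_filter.1 hp).2
      linarith
    · rw [one_mul]
      refine ENNReal.ofReal_le_ofReal (Real.exp_le_exp.2 ?_)
      have := Real.exp_neg_one_lt_d9
      nlinarith
  have e2 : ∑ p : TextPair n with 3 * (ε * n) < x p + y p, pairMass ε p ≤
      ENNReal.ofReal (1 * r) := by
    refine (sum_pairMass_le_of_count (s₁ := 1 / 4) (s₂ := 1 / 4) (E := 3 / 4 * (ε * n)) h0.le
      (by linarith) _ fun p hp => ?_).trans ?_
    · have := (Finset.mem_filter.1 hp).2
      linarith
    · rw [one_mul]
      refine ENNReal.ofReal_le_ofReal (Real.exp_le_exp.2 ?_)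
      have := Real.exp_bound_div_one_sub_of_interval' (x := 1 / 4) (by norm_num) (by norm_num)
      norm_num at this ⊢
      nlinarith
  have hexp : ε * n * (Real.exp (ε / 4) + Real.exp (-(ε / 4)) - 2) ≤ ε ^ 3 / 8 * n := by
    have h2 := (abs_le.1 (Real.abs_exp_sub_one_sub_id_le (x := ε / 4) (by
      rw [abs_of_nonneg (by positivity)]; linarith))).2
    have h3 := (abs_le.1 (Real.abs_exp_sub_one_sub_id_le (x := -(ε / 4)) (by
      rw [abs_neg, abs_of_nonneg (by positivity)]; linarith))).2
    calc _ ≤ ε * n * (2 * (ε / 4) ^ 2) := by gcongr; linarith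
      _ = _ := by ring
  have e3 : ∑ p : TextPair n with ε ^ 2 * n < x p - y p, pairMass ε p ≤
      ENNReal.ofReal (1 * r) := by
    -- The tilt `s = ε / 4` minimises `2 * s ^ 2 * ε - s * ε ^ 2`, with minimum `-(ε ^ 3 / 8)`; this
    -- is the rate in `r`.
    refine (sum_pairMass_le_of_count (s₁ := ε / 4) (s₂ := -(ε / 4)) (E := ε ^ 3 / 4 * n) h0.le
      (by linarith) _ fun p hp => ?_).trans ?_
    · have := mul_le_mul_of_nonneg_left (Finset.mem_filter.1 hp).2.le (by linarith : 0 ≤ ε / 4)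
      simp only [hx, hy] at this
      linarith
    · rw [one_mul]
      exact ENNReal.ofReal_le_ofReal (Real.exp_le_exp.2 (by linarith))
  have e4 : ∑ p : TextPair n with ε ^ 2 * n < y p - x p, pairMass ε p ≤
      ENNReal.ofReal (1 * r) := by
    refine (sum_pairMass_le_of_count (s₁ := -(ε / 4)) (s₂ := ε / 4) (E := ε ^ 3 / 4 * n) h0.le
      (by linarith) _ fun p hp => ?_).trans ?_
    · have := mul_le_mul_of_nonneg_left (Finset.mem_filter.1 hp).2.le (by linarith : 0 ≤ ε / 4)
      simp only [hx, hy] at this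
      linarith
    · rw [one_mul]
      refine ENNReal.ofReal_le_ofReal (Real.exp_le_exp.2 ?_)
      rw [add_comm (Real.exp (ε / 4))] at hexp
      linarith
  -- the typical behaviour of the numbers of ones
  set T : TextPair n → Prop := fun p => ε * n ≤ x p + y p ∧ x p + y p ≤ 3 * (ε * n) ∧
    x p - y p ≤ ε ^ 2 * n ∧ y p - x p ≤ ε ^ 2 * n with hT
  have hD : ∀ p, T p → ((((textList p.1).count true - (textList p.2).count true) +
      ((textList p.2).count true - (textList p.1).count true) : ℕ) : ℝ) ≤ ε ^ 2 * n := by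
    intro p hp
    rcases le_total ((textList p.1).count true) ((textList p.2).count true) with h | h
    · rw [Nat.sub_eq_zero_of_le h, zero_add, Nat.cast_sub h]; exact hp.2.2.2
    · rw [Nat.sub_eq_zero_of_le h, add_zero, Nat.cast_sub h]; exact hp.2.2.1
  have hcard : ∀ p : TextPair n, ((onePositions p).card : ℝ) = x p + y p := fun p => by
    rw [card_onePositions, Nat.cast_add]
  have e5 : ∑ p : TextPair n with T p ∧
      ((changingOnes p 1).card : ℝ) < 1 / 100000 * (onePositions p).card,
      pairMass ε p ≤ ENNReal.ofReal (C₁ * r) := by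
    -- Since `c = 2 * τ`, the number of segments cancels against the gap bound. The term `3 / 50` is
    -- `2000` times `3 / 100000`; both losses stay below the gain `2 * b * n = ε ^ 2 * n / 2`.
    refine (key₁ n _ (-(ε ^ 2 * n / 16) - 3 / 50 * (ε ^ 2 * n)) fun p hp => ?_).trans
      (ENNReal.ofReal_le_ofReal (mul_le_mul_of_nonneg_left (Real.exp_le_exp.2 ?_) hC₁))
    · obtain ⟨hTp, hlt⟩ := (Finset.mem_filter.1 hp).2
      obtain ⟨l, hl, h2, h3, h4, -⟩ := exists_alignment_of_textPair p
      refine ⟨l, hl, h3, ?_⟩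
      have h2' := (Nat.cast_le (α := ℝ)).2 h2
      rw [Nat.cast_add, Nat.cast_mul, Nat.cast_ofNat] at h2'
      have h4' : ((l.map fun s => scarceOnes s + scarceOnes s.swap).sum : ℝ) ≤
        (changingOnes p 1).card := by exact_mod_cast h4
      rw [hcard] at hlt
      have h5 : ((l.map fun s => scarceOnes s + scarceOnes s.swap).sum : ℝ) ≤
        3 / 100000 * (ε * n) := by linarith [hTp.2.1]
      have h6 := mul_le_mul_of_nonneg_left h5 (by linarith : 0 ≤ 2000 * ε)
      have h7 := h2'.trans (add_le_add_right (hD p hTp) _)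
      linarith
    · linarith
  have e6 : ∑ p : TextPair n with T p ∧
      1 / 200000 * ((onePositions p).card : ℝ) < (changingOnes p (-1)).card,
      pairMass ε p ≤ ENNReal.ofReal (C₂ * r) := by
    -- Here `c - 2 * τ = 1`, so each segment pair earns one unit, and there are at least half as
    -- many of them as lowering ones. The price `400 * ε ^ 2 * n` of the shrunken letters is smaller
    -- because `ε ≤ 1 / 1000000000`.
    refine (key₂ n _ (1 / 400000 * (ε * n) - ε ^ 2 * n / 16) fun p hp => ?_).trans
      (ENNReal.ofReal_le_ofReal (mul_le_mul_of_nonneg_left (Real.exp_le_exp.2 ?_) hC₂))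
    · obtain ⟨hTp, hlt⟩ := (Finset.mem_filter.1 hp).2
      obtain ⟨l, hl, h2, -, -, h5⟩ := exists_alignment_of_textPair p
      refine ⟨l, hl, fun _ _ _ => trivial, ?_⟩
      have h2' := (Nat.cast_le (α := ℝ)).2 h2
      rw [Nat.cast_add, Nat.cast_mul, Nat.cast_ofNat] at h2'
      have h5' : ((changingOnes p (-1)).card : ℝ) ≤ 2 * l.length := by exact_mod_cast h5
      rw [hcard] at hlt
      have h7 := h2'.trans (add_le_add_right (hD p hTp) _)
      rw [zero_mul]
      linarith [hTp.1]
    · linarith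
  have hsub : (Finset.univ.filter fun p : TextPair n => p ∉ goodPairs n) ⊆
      Finset.univ.filter fun p => x p + y p < ε * n ∨ 3 * (ε * n) < x p + y p ∨
        ε ^ 2 * n < x p - y p ∨ ε ^ 2 * n < y p - x p ∨
        (T p ∧ ((changingOnes p 1).card : ℝ) < 1 / 100000 * (onePositions p).card) ∨
        (T p ∧ 1 / 200000 * ((onePositions p).card : ℝ) < (changingOnes p (-1)).card) := by
    intro p hp
    rw [Finset.mem_filter] at hp ⊢
    refine ⟨hp.1, ?_⟩
    by_contra! h
    obtain ⟨a1, a2, a3, a4, a5, a6⟩ := h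
    have hTp : T p := ⟨a1, a2, a3, a4⟩
    refine hp.2 ⟨?_, a5 hTp, a6 hTp⟩
    have : (0 : ℝ) < (onePositions p).card := by rw [hcard]; linarith
    exact_mod_cast this
  refine (Finset.sum_le_sum_of_subset hsub).trans ?_
  have hr0 : 0 ≤ r := Real.exp_nonneg _
  simp only [add_mul]
  rw [ENNReal.ofReal_add (by positivity) (by positivity),
    ENNReal.ofReal_add (by positivity) (by positivity),
    ENNReal.ofReal_add (by positivity) (by positivity),
    ENNReal.ofReal_add (by positivity) (by positivity),
    ENNReal.ofReal_add (by positivity) (by positivity)]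
  exact (sum_filter_or_le _ _ _ _).trans (add_le_add e1 <|
    (sum_filter_or_le _ _ _ _).trans (add_le_add e2 <|
    (sum_filter_or_le _ _ _ _).trans (add_le_add e3 <|
    (sum_filter_or_le _ _ _ _).trans (add_le_add e4 <|
    (sum_filter_or_le _ _ _ _).trans (add_le_add e5 e6)))))
end

theorem theorem2p2 :
    ∃ α₁ α₂ : ℝ, α₂ < α₁ ∧
      ∃ B : (n : ℕ) → Set (TextPair n),
        (∀ (ε : unitInterval), 0 < (ε : ℝ) → (ε : ℝ) ≤ 1 / 2 →
          ∀ (n : ℕ) (p : TextPair n), p ∈ B n →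
            α₁ ≤ (cond (jointLaw n ε) (originalIn {p})).real (lcsChange n 1) ∧
            (cond (jointLaw n ε) (originalIn {p})).real (lcsChange n (-1)) ≤ α₂) ∧
        ∃ ε₀ : ℝ, 0 < ε₀ ∧ ε₀ ≤ 1 / 2 ∧
          ∀ (ε : unitInterval), 0 < (ε : ℝ) → (ε : ℝ) ≤ ε₀ →
            ∃ c₁ : ℝ, 0 < c₁ ∧ ∀ n : ℕ,
              1 - Real.exp (-c₁ * n) ≤ (jointLaw n ε).real (originalIn (B n)) := by
  classical
  refine ⟨1 / 100000, 1 / 200000, by norm_num, goodPairs, ?_, 1 / 1000000000, by norm_num,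
    by norm_num, ?_⟩
  · rintro ε h0 h1 n p ⟨hN, hp, hm⟩
    have hne := Finset.card_pos.1 hN
    have hN' : (0 : ℝ) < (onePositions p).card := by exact_mod_cast hN
    rw [cond_jointLaw_lcsChange h0 (by linarith) p hne, cond_jointLaw_lcsChange h0 (by linarith) p hne,
      le_div_iff₀ hN', div_le_iff₀ hN']
    exact ⟨hp, hm⟩
  · intro ε h0 h1
    obtain ⟨C, hC, hle⟩ := exists_sum_compl_goodPairs_le h0 h1
    have hcompl : ∀ n, (jointLaw n ε).real (originalIn (goodPairs n)) =
        1 - (jointLaw n ε).real (originalIn (goodPairs n)ᶜ) := fun n => by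
      have h := probReal_compl_eq_one_sub (μ := jointLaw n ε)
        (MeasurableSet.of_discrete (s := originalIn (goodPairs n)))
      change (jointLaw n ε).real (originalIn (goodPairs n)ᶜ) = _ at h
      linarith
    have hf : ∀ n : ℕ, 1 ≤ n → (jointLaw n ε).real (originalIn (goodPairs n)ᶜ) ≤
        C * Real.exp (-((ε : ℝ) ^ 3 / 8) * n) := fun n hn => by
      have h : (goodPairs n)ᶜ = ((Finset.univ.filter fun p : TextPair n => p ∉ goodPairs n :
          Finset (TextPair n)) : Set (TextPair n)) := by
        ext p; simp
      rw [measureReal_def, h, jointLaw_originalIn]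
      exact ENNReal.toReal_le_of_le_ofReal (by positivity) (hle n hn)
    have hlt : ∀ n : ℕ, 1 ≤ n → (jointLaw n ε).real (originalIn (goodPairs n)ᶜ) < 1 := by
      intro n hn
      obtain ⟨m, rfl⟩ : ∃ m, n = m + 1 := ⟨n - 1, by omega⟩
      obtain ⟨p, hp⟩ := exists_mem_goodPairs m
      have h2 : jointLaw (m + 1) ε (originalIn {p}) = pairMass ε p := by
        have := jointLaw_originalIn ε {p}
        simpa using this
      have h3 : 0 < jointLaw (m + 1) ε (originalIn (goodPairs (m + 1))) := by
        refine lt_of_lt_of_le (h2 ▸ pairMass_pos h0 (by linarith) p) (measure_mono ?_)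
        rintro ω hω
        change ω.1 ∈ goodPairs (m + 1)
        rwa [show ω.1 = p from hω]
      have h4 : 0 < (jointLaw (m + 1) ε).real (originalIn (goodPairs (m + 1))) :=
        ENNReal.toReal_pos h3.ne' (measure_ne_top _ _)
      linarith [hcompl (m + 1)]
    obtain ⟨c₁, hc₁, h⟩ := exists_rate (by positivity) hlt hf
    refine ⟨c₁, hc₁, fun n => ?_⟩
    rcases Nat.eq_zero_or_pos n with rfl | hn
    -- For `n = 0` the claimed lower bound is `0`.
    · simp
    · rw [hcompl n]
      linarith [h n hn]
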